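/- **Setting.** Let $A,D\in\mathbb C^{n\times n}$ and let $[\Xi\ \Xi_c]\in\mathbb C^{n\times n}$ be invertible with $[\Sigma\ \Sigma_c]=[\Xi\ \Xi_c]^{-*}$ and $$A[\Xi\ \Xi_c]=[\Xi\ \Xi_c]\begin{bmatrix}\lambda_0I+N&0\\0&A_{22}\end{bmatrix},\qquad N=\operatorname{diag}(N_1,\dots,N_k),$$ where $\lambda_0$ is not an eigenvalue of $A_{22}$ and $N_j$ is the $j\times j$ block matrix with blocks $I_{s_j}$ on the first block superdiagonal and zero blocks elsewhere ($s_1,\dots,s_{k-1}\ge 0$, $s_k>0$). Partition the columns of $\Xi$ and $\Sigma$ accordingly into blocks $\Xi_{jl},\Sigma_{jl}\in\mathbb C^{n\times s_j}$, $1\le l\le j\le k$, and put $B^{(ij)}_{lm}=\Sigma_{il}^*D\,\Xi_{jm}$, $\widetilde\Xi_i=[\Xi_{i1},\Xi_{i+1,1},\dots,\Xi_{k1}]$, $\widetilde\Xi_{i2}=[\Xi_{i2},\Xi_{i+1,2},\dots,\Xi_{k2}]$ and $W_i=[B^{(ab)}_{a1}]_{a,b=i,\dots,k}$. Let $2\le\rho\le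 k$ and suppose that $W_1,\dots,W_\rho$, and also $W_{\rho+1}$ if $\rho<k$, are invertible. (Terms with block indices greater than $k$ are void.) **Notation.** For $j\le\rho$ let $$G_j^{(\rho)}=-W_{\rho+1}^{-1}\begin{bmatrix}B^{(\rho+1,j)}_{\rho+1,1}\\\vdots\\B^{(kj)}_{k1}\end{bmatrix},\qquad G_\rho^{(\rho)}=\begin{bmatrix}G_{\rho+1,\rho}\\\vdots\\G_{k\rho}\end{bmatrix},$$ and let $W_{\rho,\rho+1}=[B^{(\rho,\rho+1)}_{\rho1},\dots,B^{(\rho k)}_{\rho1}]$, $S_\rho=B^{(\rho\rho)}_{\rho1}+W_{\rho,\rho+1}G_\rho^{(\rho)}$. Let $\Theta_\rho$ be the $\rho\times\rho$ block matrix with $I_{s_\rho}$ on the first block superdiagonal, $S_\rho$ in the lower left corner and zero blocks elsewhere. Put $$\widehat B^{(j\rho)}_{l1}=B^{(j\rho)}_{l1}+[B^{(j,\rho+1)}_{l1},\dots,B^{(jk)}_{l1}]G_\rho^{(\rho)},$$ let $\widetilde C$ have the block rows, for $\rho+1\le j\le k$, $$\widetilde C_j=\delta_{j,\rho+1}G_{\rho+1,\rho}S_\rho-\Big(\widehat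 B^{(j\rho)}_{j-1,1}+B^{(j\rho)}_{j2}+[B^{(j,\rho+1)}_{j2},\dots,B^{(jk)}_{j2}]G_\rho^{(\rho)}\Big),$$ and let $$C=\begin{bmatrix}C_{\rho+1}\\\vdots\\C_k\end{bmatrix}=W_{\rho+1}^{-1}\widetilde C+G_{\rho-1}^{(\rho)}\widehat B^{(\rho-1,\rho)}_{\rho-1,1}S_\rho^{-1},$$ $$\widehat B^{(\rho\rho)}_{\rho2}=B^{(\rho\rho)}_{\rho2}+B^{(\rho,\rho-1)}_{\rho1}\widehat B^{(\rho-1,\rho)}_{\rho-1,1}S_\rho^{-1}+W_{\rho,\rho+1}C+[B^{(\rho,\rho+1)}_{\rho2},\dots,B^{(\rho k)}_{\rho2}]G_\rho^{(\rho)}.$$ Let $[\widetilde\Phi_\rho\ \widetilde\Phi_c]$ be invertible with $\Theta_\rho\widetilde\Phi_\rho=\widetilde\Phi_\rho\Omega$ and $\Theta_\rho\widetilde\Phi_c=\widetilde\Phi_c\Omega_c$, where $\Omega\in\mathbb C^{r\times r}$ and $\Omega_c$ have no common eigenvalue, and let $Q_1,Q_2$ be the top blocks (the first $s_\rho$ rows)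 of $\widetilde\Phi_\rho,\widetilde\Phi_c$. Let $\widetilde Q_1,\widetilde Q_2$ satisfy $\widetilde Q_1S_\rho=\Omega^\rho\widetilde Q_1$, $\widetilde Q_2S_\rho=\Omega_c^\rho\widetilde Q_2$ and be such that the inverses $$M=\Big(\sum_{j=0}^{\rho-1}\Omega^{\rho-1-j}\widetilde Q_1Q_1\Omega^j\Big)^{-1},\qquad M_c=\Big(\sum_{j=0}^{\rho-1}\Omega_c^{\rho-1-j}\widetilde Q_2Q_2\Omega_c^j\Big)^{-1}$$ exist. Put $$\begin{bmatrix}\Delta_{11}&\Delta_{12}\\\Delta_{21}&\Delta_{22}\end{bmatrix}=\begin{bmatrix}M&0\\0&M_c\end{bmatrix}\begin{bmatrix}\Omega\widetilde Q_1&\widetilde Q_1\\\Omega_c\widetilde Q_2&\widetilde Q_2\end{bmatrix}\begin{bmatrix}\widehat B^{(\rho\rho)}_{\rho-1,1}&0\\0&\widehat B^{(\rho\rho)}_{\rho2}\end{bmatrix}\begin{bmatrix}Q_1&Q_2\\Q_1\Omega&Q_2\Omega_c\end{bmatrix},$$ let $Y$ solve $\Omega_cY-Y\Omega+\Delta_{21}=0$,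 and let $$H_0=\widetilde\Xi_\rho\begin{bmatrix}I\\G_\rho^{(\rho)}\end{bmatrix}Q_1,$$ $$H_1=\widetilde\Xi_{\rho-1}\begin{bmatrix}\widehat B^{(\rho-1,\rho)}_{\rho-1,1}S_\rho^{-1}\\0\\C_{\rho+1}\\\vdots\\C_k\end{bmatrix}Q_1\Omega+\widetilde\Xi_\rho\begin{bmatrix}I\\G_\rho^{(\rho)}\end{bmatrix}Q_2Y+\widetilde\Xi_{\rho2}\begin{bmatrix}I\\G_\rho^{(\rho)}\end{bmatrix}Q_1\Omega.$$ **Theorem.** As $t\to0^+$ the following hold. 1. There are matrices $H(t)\in\mathbb C^{n\times r}$ and $C(t)\in\mathbb C^{r\times r}$ such that, for all sufficiently small $t>0$, $H(t)$ has rank $r$ and $(A+tD)H(t)=H(t)C(t)$, and $$C(t)=\lambda_0I+t^{1/\rho}\Omega+t^{2/\rho}\Delta_{11}+O(t^{3/\rho}),\qquad H(t)=H_0+t^{1/\rho}H_1+O(t^{2/\rho}).$$ 2. $(A+tD)(H_0+t^{1/\rho}H_1)=(H_0+t^{1/\rho}H_1)\big(\lambda_0I+t^{1/\rho}\Omega+t^{2/\rho}\Delta_{11}\big)+O(t^{2/\rho}).$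 -/

import Mathlib

open Matrix Filter Topology Asymptotics

noncomputable section

namespace JordanPert

/-- Coordinates of the `lam0`-part of `A` in its modified Jordan form with `s i` Jordan blocks of
size `i`, `1 ≤ i ≤ k`: the coordinate `(i, l, x)` is the `x`-th coordinate in sub-block `l`
(`1 ≤ l ≤ i`) of block `i`. All block indices start at `1`. -/
abbrev JIdx (k : ℕ) (s : ℕ → ℕ) : Type :=
  (i : Set.Icc 1 k) × (Set.Icc 1 (i : ℕ) × Fin (s i))

/-- Coordinates for one sub-block from each of the blocks `i, i + 1, …, k`
(empty if `i > k`). -/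
abbrev TIdx (i k : ℕ) (s : ℕ → ℕ) : Type :=
  (j : Set.Icc i k) × Fin (s j)

variable {k : ℕ} {s : ℕ → ℕ}

/-- `N = diag(N_1, …, N_k)`, where `N_j` is the `j × j` block matrix with identity blocks of order
`s j` on the first block superdiagonal. -/
def jordanN (k : ℕ) (s : ℕ → ℕ) : Matrix (JIdx k s) (JIdx k s) ℂ :=
  Matrix.of fun p q =>
    if (p.1 : ℕ) = q.1 ∧ (q.2.1 : ℕ) = p.2.1 + 1 ∧ (p.2.2 : ℕ) = q.2.2 then 1 else 0

/-- The sub-block `X_{il}` of the columns of `X` (zero when the block is void, that is, unless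
`1 ≤ i ≤ k` and `1 ≤ l ≤ i`). -/
def colBlk {ι : Type*} (X : Matrix ι (JIdx k s) ℂ) (i l : ℕ) : Matrix ι (Fin (s i)) ℂ :=
  Matrix.of fun a x =>
    if h : (1 ≤ i ∧ i ≤ k) ∧ (1 ≤ l ∧ l ≤ i) then X a ⟨⟨i, h.1⟩, ⟨l, h.2⟩, x⟩ else 0

/-- The block row `[X_{il}, X_{i+1,l}, …, X_{kl}]`. -/
def colsFrom {ι : Type*} (X : Matrix ι (JIdx k s) ℂ) (i l : ℕ) : Matrix ι (TIdx i k s) ℂ :=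
  Matrix.of fun a q => colBlk X q.1 l a q.2

/-- The sub-block `B^{(ij)}_{lm}` of `B` (zero when void). -/
def blk (B : Matrix (JIdx k s) (JIdx k s) ℂ) (i j l m : ℕ) : Matrix (Fin (s i)) (Fin (s j)) ℂ :=
  (colBlk (colBlk B j m)ᵀ i l)ᵀ

/-- The block row `[B^{(i,j)}_{lm}, B^{(i,j+1)}_{lm}, …, B^{(i,k)}_{lm}]`. -/
def blkRow (B : Matrix (JIdx k s) (JIdx k s) ℂ) (i j l m : ℕ) :
    Matrix (Fin (s i)) (TIdx j k s) ℂ :=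
  Matrix.of fun x q => blk B i q.1 l m x q.2

/-- `W_i = [B^{(ab)}_{a1}]`, with block indices `a, b = i, …, k`. -/
def W (B : Matrix (JIdx k s) (JIdx k s) ℂ) (i : ℕ) : Matrix (TIdx i k s) (TIdx i k s) ℂ :=
  Matrix.of fun p q => blk B p.1 q.1 p.1 1 p.2 q.2

/-- `Z_{i,j}` for `j < i`: the block column with blocks `B^{(aj)}_{a1}`, `a = i, …, k`. -/
def Z (B : Matrix (JIdx k s) (JIdx k s) ℂ) (i j : ℕ) : Matrix (TIdx i k s) (Fin (s j)) ℂ :=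
  Matrix.of fun p y => blk B p.1 j p.1 1 p.2 y

/-- `G_j^{(ρ)} = -W_{ρ+1}⁻¹ Z_{ρ+1,j}` for `j ≤ ρ`. -/
def G (B : Matrix (JIdx k s) (JIdx k s) ℂ) (ρ j : ℕ) : Matrix (TIdx (ρ + 1) k s) (Fin (s j)) ℂ :=
  -((W B (ρ + 1))⁻¹ * Z B (ρ + 1) j)

/-- `S_ρ = B^{(ρρ)}_{ρ1} + W_{ρ,ρ+1} G_ρ^{(ρ)}`. -/
def S (B : Matrix (JIdx k s) (JIdx k s) ℂ) (ρ : ℕ) : Matrix (Fin (s ρ)) (Fin (s ρ)) ℂ :=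
  blk B ρ ρ ρ 1 + blkRow B ρ (ρ + 1) ρ 1 * G B ρ ρ

/-- `Θ_ρ`: the `ρ × ρ` block matrix with identity blocks on the first block superdiagonal, `S_ρ` in
the lower left corner, and zero blocks elsewhere (`Θ_1 = S_1`). -/
def Theta (B : Matrix (JIdx k s) (JIdx k s) ℂ) (ρ : ℕ) :
    Matrix (Fin ρ × Fin (s ρ)) (Fin ρ × Fin (s ρ)) ℂ :=
  Matrix.of fun p q =>
    if (q.1 : ℕ) = p.1 + 1 then (if p.2 = q.2 then 1 else 0)
    else if (p.1 : ℕ) + 1 = ρ ∧ (q.1 : ℕ) = 0 then S B ρ p.2 q.2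
    else 0

/-- `B̂^{(jρ)}_{l1} = B^{(jρ)}_{l1} + [B^{(j,ρ+1)}_{l1}, …, B^{(jk)}_{l1}] G_ρ^{(ρ)}`. -/
def Bhat (B : Matrix (JIdx k s) (JIdx k s) ℂ) (ρ j l : ℕ) : Matrix (Fin (s j)) (Fin (s ρ)) ℂ :=
  blk B j ρ l 1 + blkRow B j (ρ + 1) l 1 * G B ρ ρ

/-- `C̃`: its block row `j`, for `ρ + 1 ≤ j ≤ k`, is
`δ_{j,ρ+1} G_{ρ+1,ρ} S_ρ - (B̂^{(jρ)}_{j-1,1} + B^{(jρ)}_{j2}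
  + [B^{(j,ρ+1)}_{j2}, …, B^{(jk)}_{j2}] G_ρ^{(ρ)})`. -/
def Ctilde (B : Matrix (JIdx k s) (JIdx k s) ℂ) (ρ : ℕ) :
    Matrix (TIdx (ρ + 1) k s) (Fin (s ρ)) ℂ :=
  Matrix.of fun p y =>
    (if (p.1 : ℕ) = ρ + 1 then (G B ρ ρ * S B ρ) p y else 0)
      - (Bhat B ρ p.1 (p.1 - 1) + blk B p.1 ρ p.1 2
          + blkRow B p.1 (ρ + 1) p.1 2 * G B ρ ρ) p.2 y

/-- `C = W_{ρ+1}⁻¹ C̃ + G_{ρ-1}^{(ρ)} B̂^{(ρ-1,ρ)}_{ρ-1,1} S_ρ⁻¹`, with blocks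
`C_{ρ+1}, …, C_k`. -/
def Cmat (B : Matrix (JIdx k s) (JIdx k s) ℂ) (ρ : ℕ) :
    Matrix (TIdx (ρ + 1) k s) (Fin (s ρ)) ℂ :=
  (W B (ρ + 1))⁻¹ * Ctilde B ρ + G B ρ (ρ - 1) * Bhat B ρ (ρ - 1) (ρ - 1) * (S B ρ)⁻¹

/-- `B̂^{(ρρ)}_{ρ2} = B^{(ρρ)}_{ρ2} + B^{(ρ,ρ-1)}_{ρ1} B̂^{(ρ-1,ρ)}_{ρ-1,1} S_ρ⁻¹ + W_{ρ,ρ+1} C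
  + [B^{(ρ,ρ+1)}_{ρ2}, …, B^{(ρk)}_{ρ2}] G_ρ^{(ρ)}`. -/
def Bhat2 (B : Matrix (JIdx k s) (JIdx k s) ℂ) (ρ : ℕ) : Matrix (Fin (s ρ)) (Fin (s ρ)) ℂ :=
  blk B ρ ρ ρ 2 + blk B ρ (ρ - 1) ρ 1 * Bhat B ρ (ρ - 1) (ρ - 1) * (S B ρ)⁻¹
    + blkRow B ρ (ρ + 1) ρ 1 * Cmat B ρ + blkRow B ρ (ρ + 1) ρ 2 * G B ρ ρ

/-- `∑_{j<ρ} Ω^{ρ-1-j} Q̃ Q Ω^j`, the inverse of the normalizing factor `M`. -/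
def Msum {m r : ℕ} (ρ : ℕ) (Ω : Matrix (Fin r) (Fin r) ℂ) (Qt : Matrix (Fin r) (Fin m) ℂ)
    (Q : Matrix (Fin m) (Fin r) ℂ) : Matrix (Fin r) (Fin r) ℂ :=
  ∑ j ∈ Finset.range ρ, Ω ^ (ρ - 1 - j) * Qt * Q * Ω ^ j

/-- The `2 × 2` block matrix `Δ`, the product of
`diag(M, M_c)`, `[Ω Q̃_1, Q̃_1; Ω_c Q̃_2, Q̃_2]`, `diag(B̂^{(ρρ)}_{ρ-1,1}, B̂^{(ρρ)}_{ρ2})` and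
`[Q_1, Q_2; Q_1 Ω, Q_2 Ω_c]`. -/
def Delta (B : Matrix (JIdx k s) (JIdx k s) ℂ) (ρ : ℕ) {r r' : ℕ}
    (Ω : Matrix (Fin r) (Fin r) ℂ) (Ωc : Matrix (Fin r') (Fin r') ℂ)
    (Q1 : Matrix (Fin (s ρ)) (Fin r) ℂ) (Q2 : Matrix (Fin (s ρ)) (Fin r') ℂ)
    (Qt1 : Matrix (Fin r) (Fin (s ρ)) ℂ) (Qt2 : Matrix (Fin r') (Fin (s ρ)) ℂ) :
    Matrix (Fin r ⊕ Fin r') (Fin r ⊕ Fin r') ℂ :=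
  fromBlocks (Msum ρ Ω Qt1 Q1)⁻¹ 0 0 (Msum ρ Ωc Qt2 Q2)⁻¹
    * fromBlocks (Ω * Qt1) Qt1 (Ωc * Qt2) Qt2
    * fromBlocks (Bhat B ρ ρ (ρ - 1)) 0 0 (Bhat2 B ρ)
    * fromBlocks Q1 Q2 (Q1 * Ω) (Q2 * Ωc)

/-- The block column, with block rows `a, …, k`, whose block row `i` is `X`, whose block rows
`b, …, k` are those of `Y`, and whose other block rows are zero (used with `a ≤ i < b`). -/
def stack {κ : Type*} (a i b : ℕ) (X : Matrix (Fin (s i)) κ ℂ) (Y : Matrix (TIdx b k s) κ ℂ) :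
    Matrix (TIdx a k s) κ ℂ :=
  Matrix.of fun p c =>
    if h : (p.1 : ℕ) = i then X (Fin.cast (congrArg s h) p.2) c
    else if h' : b ≤ (p.1 : ℕ) then Y ⟨⟨p.1, h', p.1.2.2⟩, p.2⟩ c
    else 0

/-- `[I; G_ρ^{(ρ)}]`. -/
def IG (B : Matrix (JIdx k s) (JIdx k s) ℂ) (ρ : ℕ) : Matrix (TIdx ρ k s) (Fin (s ρ)) ℂ :=
  stack ρ ρ (ρ + 1) 1 (G B ρ ρ)

/-- `H_0 = Ξ̃_ρ [I; G_ρ^{(ρ)}] Q_1`. -/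
def H0 {n r : ℕ} (B : Matrix (JIdx k s) (JIdx k s) ℂ) (Xi : Matrix (Fin n) (JIdx k s) ℂ) (ρ : ℕ)
    (Q1 : Matrix (Fin (s ρ)) (Fin r) ℂ) : Matrix (Fin n) (Fin r) ℂ :=
  colsFrom Xi ρ 1 * IG B ρ * Q1

/-- `H_1 = Ξ̃_{ρ-1} [B̂^{(ρ-1,ρ)}_{ρ-1,1} S_ρ⁻¹; 0; C_{ρ+1}; …; C_k] Q_1 Ω
  + Ξ̃_ρ [I; G_ρ^{(ρ)}] Q_2 Y + Ξ̃_{ρ2} [I; G_ρ^{(ρ)}] Q_1 Ω`. -/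
def H1 {n r r' : ℕ} (B : Matrix (JIdx k s) (JIdx k s) ℂ) (Xi : Matrix (Fin n) (JIdx k s) ℂ)
    (ρ : ℕ) (Ω : Matrix (Fin r) (Fin r) ℂ) (Q1 : Matrix (Fin (s ρ)) (Fin r) ℂ)
    (Q2 : Matrix (Fin (s ρ)) (Fin r') ℂ) (Y : Matrix (Fin r') (Fin r) ℂ) :
    Matrix (Fin n) (Fin r) ℂ :=
  colsFrom Xi (ρ - 1) 1
      * stack (ρ - 1) (ρ - 1) (ρ + 1) (Bhat B ρ (ρ - 1) (ρ - 1) * (S B ρ)⁻¹) (Cmat B ρ) * Q1 * Ω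
    + colsFrom Xi ρ 1 * IG B ρ * Q2 * Y
    + colsFrom Xi ρ 2 * IG B ρ * Q1 * Ω

/-- Entrywise `F(t) = O(t^c)` as `t → 0+`. -/
def IsOPow {m n : Type*} (F : ℝ → Matrix m n ℂ) (c : ℝ) : Prop :=
  ∀ i j, (fun t => F t i j) =O[𝓝[>] (0 : ℝ)] fun t => t ^ c

/-- The real fractional power `t^c`, as a complex number. -/
def tpow (t c : ℝ) : ℂ := ((t ^ c : ℝ) : ℂ)

end JordanPert

end

/-! In the basis `V = [Ξ Ξ_c]` the matrix `A - λ₀` becomes `diag(N, A₂₂ - λ₀)`. Put `c = t^{1/ρ}`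
and seek the invariant subspace as `H = V c^d v` and `C = λ₀ + c X`, where `c^d` is diagonal with
exponent `min (l - 1) ρ` at level `l` of every Jordan block and `0` on the complement. Cancelling
powers of `c` row by row turns invariance into `N v + c^g D c^d v - c^h v X = 0`, which is
polynomial in `c`; `unscale` goes back. At `c = 0`, level `l` of a block reads `x_{l+1} + [l ≥ ρ] (B
x_1)_l = [l ≤ ρ] x_l X`. With `X = Ω`, which is invertible, the blocks smaller than `ρ` vanish; the
last levels of the larger blocks are solved with `W_{ρ+1}`, which produces `G`; what remains in
block `ρ` is governed by the Schur complement `S_ρ`, that is, by `Θ Φ = Φ Ω`. The resulting solution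
is `lead`.

This solution is not isolated, since a basis of the subspace can be changed. The choice is removed
by fixing `P₁ v`, where `P₁, P₂` are the rows of `[Φ Φ_c]⁻¹`. The linearization is then injective
(`LinEq.eq_zero`): `P₁` kills the variation of `X`, and `P₂` leaves a homogeneous Sylvester equation
with disjoint spectra. The analytic implicit function theorem gives analytic `v(c)` and `X(c)`
(`exists_analytic_family`).

Differentiating at `c = 0` gives the same linear system with right-hand side `firstRhs`, solved in
`LinEq.first_order`: `P₁` yields `X'(0) = Δ₁₁`, and `P₂` yields the Sylvester equation of `Y`. The
solvents enter because `P₁` equals `M [Ω^{ρ-1} Q̃, …, Ω Q̃, Q̃]` (`leftRow_eq`); the right-hand side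
lives only in the last two levels of block `ρ`, so only `Ω Q̃` and `Q̃` survive in `Δ`. Taylor
expansion at `c = t^{1/ρ}` gives the asymptotics, with one extra factor `c` in the error of `C`;
approximate invariance follows from exact invariance. -/

noncomputable section

namespace JordanPert

/-! ### Analytic implicit functions and first order calculus for scaled equations -/

/-- Analytic implicit function theorem in finite dimension, with invertibility of the partial
derivative reduced to injectivity. -/
theorem exists_analyticAt_implicit {E F : Type*} [NormedAddCommGroup E] [NormedSpace ℂ E]
    [FiniteDimensional ℂ E] [NormedAddCommGroup F] [NormedSpace ℂ F]
    [FiniteDimensional ℂ F] (hdim : Module.finrank ℂ E = Module.finrank ℂ F)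
    (f : ℂ × E → F) (z₀ : E) (hf : ContDiffAt ℂ (⊤ : WithTop ℕ∞) f (0, z₀))
    (hinj : ∀ w : E, HasDerivAt (fun c : ℂ => f (0, z₀ + c • w)) 0 0 → w = 0) :
    ∃ z : ℂ → E, AnalyticAt ℂ z 0 ∧ z 0 = z₀ ∧ ∀ᶠ c in 𝓝 0, f (c, z c) = f (0, z₀) := by
  have : CompleteSpace E := FiniteDimensional.complete ℂ E
  have hd : HasFDerivAt f (fderiv ℂ f (0, z₀)) (0, z₀) :=
    (hf.differentiableAt (by simp)).hasFDerivAt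
  have hker : Function.Injective (fderiv ℂ f (0, z₀) ∘L .inr ℂ ℂ E) := by
    rw [injective_iff_map_eq_zero]
    intro w hw
    apply hinj
    have hg : HasDerivAt (fun c : ℂ => ((0 : ℂ), z₀ + c • w)) ((0 : ℂ), w) 0 := by
      have h1 := ((hasDerivAt_id (0 : ℂ)).smul_const w).const_add z₀
      simpa using (hasDerivAt_const (0 : ℂ) (0 : ℂ)).prodMk h1
    have h2 := HasFDerivAt.comp_hasDerivAt (f := fun c : ℂ => ((0 : ℂ), z₀ + c • w)) (0 : ℂ)
      (by simpa using hd) hg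
    have h3 : fderiv ℂ f (0, z₀) (0, w) = 0 := by simpa using hw
    rw [h3] at h2
    exact h2
  have hbij : (fderiv ℂ f (0, z₀) ∘L .inr ℂ ℂ E).IsInvertible := by
    refine ⟨(LinearEquiv.ofInjectiveOfFinrankEq
      (fderiv ℂ f (0, z₀) ∘L .inr ℂ ℂ E).toLinearMap hker hdim).toContinuousLinearEquiv, ?_⟩
    ext w
    rfl
  refine ⟨hf.implicitFunction (by simp) hbij, ?_, ?_, ?_⟩
  · exact (hf.contDiffAt_implicitFunction (by simp) hbij).analyticAt
  · exact hf.implicitFunction_apply_self (by simp) hbij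
  · exact hf.eventually_apply_implicitFunction (by simp) hbij

/-- Second order Taylor bound for an analytic function. -/
theorem isBigO_sq_of_analyticAt {f : ℂ → ℂ} (hf : AnalyticAt ℂ f 0) {f₁ : ℂ}
    (h₁ : HasDerivAt f f₁ 0) :
    (fun c => f c - (f 0 + c * f₁)) =O[𝓝 0] fun c => c ^ 2 := by
  obtain ⟨p, hp⟩ := hf
  have h := hp.isBigO_sub_partialSum_pow 2
  have h1 : p.coeff 1 = f₁ := hp.hasDerivAt.unique h₁
  have h0 : p.coeff 0 = f 0 := by
    rw [FormalMultilinearSeries.coeff, ← hp.coeff_zero]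
  simp only [zero_add] at h
  refine (h.congr_left ?_).trans ?_
  · intro c
    simp [FormalMultilinearSeries.partialSum, Finset.sum_range_succ, h0, h1]
  · exact IsBigO.of_bound 1 (by simp)

/-- The diagonal scaling matrix `diag(c^{f p})`. -/
def scl {K : Type*} [DecidableEq K] (f : K → ℕ) (c : ℂ) : Matrix K K ℂ :=
  diagonal fun p => c ^ f p

/-- The diagonal projection on the coordinates `p` with `f p = a`. -/
def lev {K : Type*} [DecidableEq K] (f : K → ℕ) (a : ℕ) : Matrix K K ℂ :=
  diagonal fun p => if f p = a then 1 else 0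

theorem scl_zero {K : Type*} [DecidableEq K] (f : K → ℕ) : scl f 0 = lev f 0 := by
  simp only [scl, lev, zero_pow_eq]

/-- Entrywise differentiability at `0`. -/
def HasDerivZero {m n : Type*} (F : ℂ → Matrix m n ℂ) (F' : Matrix m n ℂ) : Prop :=
  ∀ i j, HasDerivAt (fun c => F c i j) (F' i j) 0

/-- Entrywise analyticity at `0`. -/
def AnalyticZero {m n : Type*} (F : ℂ → Matrix m n ℂ) : Prop :=
  ∀ i j, AnalyticAt ℂ (fun c => F c i j) 0

section calculus

variable {m n p : Type*} {F F₁ : ℂ → Matrix m n ℂ} {F' F₁' : Matrix m n ℂ}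

theorem HasDerivZero.unique (h : HasDerivZero F F') (h₁ : HasDerivZero F F₁') : F' = F₁' := by
  ext i j
  exact (h i j).unique (h₁ i j)

theorem HasDerivZero.add (h : HasDerivZero F F') (h₁ : HasDerivZero F₁ F₁') :
    HasDerivZero (fun c => F c + F₁ c) (F' + F₁') := fun i j => (h i j).add (h₁ i j)

theorem HasDerivZero.sub (h : HasDerivZero F F') (h₁ : HasDerivZero F₁ F₁') :
    HasDerivZero (fun c => F c - F₁ c) (F' - F₁') := fun i j => (h i j).sub (h₁ i j)

theorem HasDerivZero.const (X : Matrix m n ℂ) : HasDerivZero (fun _ => X) 0 :=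
  fun i j => hasDerivAt_const (0 : ℂ) (X i j)

theorem HasDerivZero.mul [Fintype n] {G : ℂ → Matrix n p ℂ} {G' : Matrix n p ℂ}
    (h : HasDerivZero F F') (hG : HasDerivZero G G') :
    HasDerivZero (fun c => F c * G c) (F' * G 0 + F 0 * G') := by
  intro i j
  simp only [Matrix.mul_apply, Matrix.add_apply, ← Finset.sum_add_distrib]
  exact HasDerivAt.fun_sum fun l _ => (h i l).mul (hG l j)

theorem HasDerivZero.congr (h : HasDerivZero F F') (h' : ∀ᶠ c in 𝓝 0, F₁ c = F c) :
    HasDerivZero F₁ F' :=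
  fun i j => (h i j).congr_of_eventuallyEq (h'.mono fun c hc => by simp only [hc])

theorem hasDerivZero_scl {K : Type*} [DecidableEq K] (f : K → ℕ) :
    HasDerivZero (scl f) (lev f 1) := by
  intro i j
  by_cases hij : i = j
  · subst hij
    simp only [scl, lev, diagonal_apply_eq]
    generalize f i = a
    -- The exponent `a - 1` is truncated: at `a = 0` the factor `a` removes the spurious `0 ^ 0 =
    -- 1`.
    have ha : (if a = 1 then 1 else 0 : ℂ) = a * 0 ^ (a - 1) := by
      rcases a with _ | _ | a <;> simp
    rw [ha]
    exact hasDerivAt_pow a (0 : ℂ)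
  · simp only [scl, lev, diagonal_apply_ne _ hij]
    exact hasDerivAt_const _ _

theorem AnalyticZero.mul [Fintype n] {G : ℂ → Matrix n p ℂ}
    (h : AnalyticZero F) (hG : AnalyticZero G) : AnalyticZero (fun c => F c * G c) := by
  intro i j
  simp only [Matrix.mul_apply]
  exact Finset.analyticAt_fun_sum _ fun l _ => (h i l).mul (hG l j)

theorem analyticZero_const (X : Matrix m n ℂ) : AnalyticZero (fun _ => X) :=
  fun _ _ => analyticAt_const

theorem analyticZero_scl {K : Type*} [DecidableEq K] (f : K → ℕ) : AnalyticZero (scl f) := by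
  intro i j
  by_cases hij : i = j
  · subst hij
    simp only [scl, diagonal_apply_eq]
    fun_prop
  · simp only [scl, diagonal_apply_ne _ hij]
    exact analyticAt_const

end calculus

/-- Analytic continuation in `c` of a solution of the scaled invariant subspace equation. -/
theorem exists_analytic_family {K : Type*} [Fintype K] [DecidableEq K] {r : ℕ}
    (A D : Matrix K K ℂ) (d g h : K → ℕ) (L : Matrix (Fin r) K ℂ)
    (v₀ : Matrix K (Fin r) ℂ) (Ω : Matrix (Fin r) (Fin r) ℂ)
    (h₀ : A * v₀ + lev g 0 * (D * (lev d 0 * v₀)) - lev h 0 * (v₀ * Ω) = 0)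
    (hinj : ∀ (x : Matrix K (Fin r) ℂ) (X : Matrix (Fin r) (Fin r) ℂ),
      A * x + lev g 0 * (D * (lev d 0 * x)) - lev h 0 * (x * Ω + v₀ * X) = 0 →
      L * x = 0 → x = 0 ∧ X = 0) :
    ∃ (v : ℂ → Matrix K (Fin r) ℂ) (X : ℂ → Matrix (Fin r) (Fin r) ℂ)
      (v₁ : Matrix K (Fin r) ℂ) (X₁ : Matrix (Fin r) (Fin r) ℂ),
      AnalyticZero v ∧ AnalyticZero X ∧ v 0 = v₀ ∧ X 0 = Ω ∧
      HasDerivZero v v₁ ∧ HasDerivZero X X₁ ∧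
      (∀ᶠ c in 𝓝 0, A * v c + scl g c * (D * (scl d c * v c)) - scl h c * (v c * X c) = 0 ∧
        L * v c = L * v₀) ∧
      A * v₁ + (lev g 1 * (D * (lev d 0 * v₀))
          + lev g 0 * (D * (lev d 1 * v₀ + lev d 0 * v₁)))
        - (lev h 1 * (v₀ * Ω) + lev h 0 * (v₁ * Ω + v₀ * X₁)) = 0 ∧
      L * v₁ = 0 := by
  let Ψ : ℂ → Matrix K (Fin r) ℂ → Matrix (Fin r) (Fin r) ℂ → Matrix K (Fin r) ℂ :=
    fun c v X => A * v + scl g c * (D * (scl d c * v)) - scl h c * (v * X)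
  let f : ℂ × ((K → Fin r → ℂ) × (Fin r → Fin r → ℂ)) →
      (K → Fin r → ℂ) × (Fin r → Fin r → ℂ) := fun p =>
    (fun i j => Ψ p.1 (of p.2.1) (of p.2.2) i j, fun i j => (L * of p.2.1) i j)
  have hf : ContDiff ℂ (⊤ : WithTop ℕ∞) f := by
    refine ContDiff.prodMk ?_ ?_
    · rw [contDiff_pi]; intro i
      rw [contDiff_pi]; intro j
      simp only [Ψ, scl, Matrix.add_apply, Matrix.sub_apply, diagonal_mul,
        Matrix.mul_apply (M := A), Matrix.mul_apply (M := D)]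
      simp only [Matrix.mul_apply, of_apply]
      fun_prop
    · rw [contDiff_pi]; intro i
      rw [contDiff_pi]; intro j
      simp only [Matrix.mul_apply, of_apply]
      fun_prop
  -- The `r × r` normalization `L * v` supplies as many equations as `X` adds unknowns, so source
  -- and target coincide and the dimension condition is `rfl`.
  obtain ⟨z, hz, hz0, hze⟩ := exists_analyticAt_implicit rfl f ((fun i j => v₀ i j), fun i j => Ω i j)
    hf.contDiffAt (by
      intro w hw
      have hv : HasDerivZero (fun c => v₀ + c • of w.1) (of w.1) := fun i j => by
        simpa using ((hasDerivAt_id (0 : ℂ)).mul_const (w.1 i j)).const_add (v₀ i j)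
      have hX : HasDerivZero (fun c => Ω + c • of w.2) (of w.2) := fun i j => by
        simpa using ((hasDerivAt_id (0 : ℂ)).mul_const (w.2 i j)).const_add (Ω i j)
      have h1 := (((HasDerivZero.const A).mul hv).add ((HasDerivZero.const (scl g 0)).mul
        ((HasDerivZero.const D).mul ((HasDerivZero.const (scl d 0)).mul hv)))).sub
        ((HasDerivZero.const (scl h 0)).mul (hv.mul hX))
      have h2 : HasDerivZero (fun c => Ψ 0 (v₀ + c • of w.1) (Ω + c • of w.2)) 0 := fun i j =>
        hasDerivAt_pi.1 (hasDerivAt_pi.1 (hw.fst) i) j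
      have h3 : HasDerivZero (fun c => L * (v₀ + c • of w.1)) 0 := fun i j =>
        hasDerivAt_pi.1 (hasDerivAt_pi.1 (hw.snd) i) j
      have h4 := h2.unique h1
      have h5 := h3.unique ((HasDerivZero.const L).mul hv)
      simp only [Matrix.zero_mul, zero_add, zero_smul, add_zero, scl_zero] at h4 h5
      obtain ⟨ha, hb⟩ := hinj _ _ h4.symm h5.symm
      exact Prod.ext (funext fun i => funext fun j => congrFun (congrFun ha i) j)
        (funext fun i => funext fun j => congrFun (congrFun hb i) j))
  let v : ℂ → Matrix K (Fin r) ℂ := fun c => of (z c).1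
  let X : ℂ → Matrix (Fin r) (Fin r) ℂ := fun c => of (z c).2
  have hva : AnalyticZero v := fun i j =>
    analyticAt_pi_iff.1 (analyticAt_pi_iff.1 (analyticAt_fst.comp hz) i) j
  have hXa : AnalyticZero X := fun i j =>
    analyticAt_pi_iff.1 (analyticAt_pi_iff.1 (analyticAt_snd.comp hz) i) j
  let v₁ : Matrix K (Fin r) ℂ := of fun i j => deriv (fun c => v c i j) 0
  let X₁ : Matrix (Fin r) (Fin r) ℂ := of fun i j => deriv (fun c => X c i j) 0
  have hv1 : HasDerivZero v v₁ := fun i j => (hva i j).differentiableAt.hasDerivAt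
  have hX1 : HasDerivZero X X₁ := fun i j => (hXa i j).differentiableAt.hasDerivAt
  have hv0 : v 0 = v₀ := by ext i j; simp [v, hz0]
  have hX0 : X 0 = Ω := by ext i j; simp [X, hz0]
  have hev : ∀ᶠ c in 𝓝 0,
      A * v c + scl g c * (D * (scl d c * v c)) - scl h c * (v c * X c) = 0 ∧
        L * v c = L * v₀ := by
    filter_upwards [hze] with c hc
    have hc1 := congrArg Prod.fst hc
    have hc2 := congrArg Prod.snd hc
    constructor
    · rw [← h₀]
      simp only [← scl_zero]
      ext i j
      exact congrFun (congrFun hc1 i) j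
    · ext i j
      exact congrFun (congrFun hc2 i) j
  refine ⟨v, X, v₁, X₁, hva, hXa, hv0, hX0, hv1, hX1, hev, ?_, ?_⟩
  · have h1 := (((HasDerivZero.const A).mul hv1).add ((hasDerivZero_scl g).mul
        ((HasDerivZero.const D).mul ((hasDerivZero_scl d).mul hv1)))).sub
        ((hasDerivZero_scl h).mul (hv1.mul hX1))
    have h2 := (HasDerivZero.const (0 : Matrix K (Fin r) ℂ)).congr (hev.mono fun c hc => hc.1)
    have h3 := h2.unique h1
    simpa only [Matrix.zero_mul, zero_add, scl_zero, hv0, hX0] using h3.symm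
  · have h2 := (HasDerivZero.const (L * v₀)).congr (hev.mono fun c hc => hc.2)
    have h3 := h2.unique ((HasDerivZero.const L).mul hv1)
    simpa using h3.symm

variable {k : ℕ} {s : ℕ → ℕ}

/-! ### Block calculus in Jordan coordinates -/

section blocks

variable {ι κ κ' : Type*}

/-- The sub-block `x_{il}` of the rows of `x` (zero when void). -/
def rowBlk (x : Matrix (JIdx k s) κ ℂ) (i l : ℕ) : Matrix (Fin (s i)) κ ℂ :=
  (colBlk xᵀ i l)ᵀ

/-- The block column with blocks `x_{jl}`, `i ≤ j ≤ k`. -/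
def rowsFrom (x : Matrix (JIdx k s) κ ℂ) (i l : ℕ) : Matrix (TIdx i k s) κ ℂ :=
  (colsFrom xᵀ i l)ᵀ

/-- The block `j` of a block column with blocks `a, …, k` (zero when void). -/
def tBlk {a : ℕ} (T : Matrix (TIdx a k s) κ ℂ) (j : ℕ) : Matrix (Fin (s j)) κ ℂ :=
  Matrix.of fun y c => if h : a ≤ j ∧ j ≤ k then T ⟨⟨j, h⟩, y⟩ c else 0

/-- The projection on the sub-blocks of level `m`. -/
def lvl (k : ℕ) (s : ℕ → ℕ) (m : ℕ) : Matrix (JIdx k s) (JIdx k s) ℂ :=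
  lev (fun p => (p.2.1 : ℕ)) m

theorem rowBlk_apply (x : Matrix (JIdx k s) κ ℂ) {i l : ℕ} (hi : i ∈ Set.Icc 1 k)
    (hl : l ∈ Set.Icc 1 i) (y : Fin (s i)) (c : κ) :
    rowBlk x i l y c = x ⟨⟨i, hi⟩, ⟨l, hl⟩, y⟩ c := by
  have : (1 ≤ i ∧ i ≤ k) ∧ (1 ≤ l ∧ l ≤ i) := ⟨hi, hl⟩
  simp [rowBlk, colBlk, this]

theorem rowBlk_void (x : Matrix (JIdx k s) κ ℂ) {i l : ℕ}
    (h : ¬((1 ≤ i ∧ i ≤ k) ∧ (1 ≤ l ∧ l ≤ i))) : rowBlk x i l = 0 := by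
  ext y c
  simp only [rowBlk, colBlk, transpose_apply, of_apply, dif_neg h, Matrix.zero_apply]

theorem rowBlk_ext {x y : Matrix (JIdx k s) κ ℂ}
    (h : ∀ i l, 1 ≤ i → i ≤ k → 1 ≤ l → l ≤ i → rowBlk x i l = rowBlk y i l) : x = y := by
  ext ⟨⟨i, hi⟩, ⟨l, hl⟩, a⟩ c
  have := congrFun (congrFun (h i l hi.1 hi.2 hl.1 hl.2) a) c
  rwa [rowBlk_apply x hi hl, rowBlk_apply y hi hl] at this

theorem rowBlk_add (x y : Matrix (JIdx k s) κ ℂ) (i l : ℕ) :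
    rowBlk (x + y) i l = rowBlk x i l + rowBlk y i l := by
  ext a c
  simp only [rowBlk, colBlk, transpose_apply, of_apply, Matrix.add_apply]
  split_ifs <;> simp

theorem rowBlk_sub (x y : Matrix (JIdx k s) κ ℂ) (i l : ℕ) :
    rowBlk (x - y) i l = rowBlk x i l - rowBlk y i l := by
  ext a c
  simp only [rowBlk, colBlk, transpose_apply, of_apply, Matrix.sub_apply]
  split_ifs <;> simp

theorem rowBlk_zero (i l : ℕ) : rowBlk (0 : Matrix (JIdx k s) κ ℂ) i l = 0 := by
  ext a c
  simp [rowBlk, colBlk]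

theorem rowBlk_mul [Fintype κ] (x : Matrix (JIdx k s) κ ℂ) (y : Matrix κ κ' ℂ) (i l : ℕ) :
    rowBlk (x * y) i l = rowBlk x i l * y := by
  ext a c
  simp only [rowBlk, colBlk, transpose_apply, of_apply, Matrix.mul_apply]
  split_ifs <;> simp

theorem rowBlk_lev_mul (d : JIdx k s → ℕ) (δ : ℕ → ℕ) (hd : ∀ p, d p = δ p.2.1) (a : ℕ)
    (x : Matrix (JIdx k s) κ ℂ) (i l : ℕ) :
    rowBlk (lev d a * x) i l = if δ l = a then rowBlk x i l else 0 := by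
  ext y c
  simp only [rowBlk, colBlk, transpose_apply, of_apply, lev, diagonal_mul, hd]
  split_ifs <;> simp_all

/-- At the last level `l = i` the block on the right is void, hence zero; this convention lets
interior and last equations share one formula. -/
theorem rowBlk_jordanN_mul (x : Matrix (JIdx k s) κ ℂ) (i : ℕ) {l : ℕ} (hl : 1 ≤ l) :
    rowBlk (jordanN k s * x) i l = rowBlk x i (l + 1) := by
  by_cases h : (1 ≤ i ∧ i ≤ k) ∧ (1 ≤ l ∧ l ≤ i)
  swap
  · rw [rowBlk_void _ h, rowBlk_void _ (by omega)]
  ext y c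
  have hi : i ∈ Set.Icc 1 k := h.1
  have hl' : l ∈ Set.Icc 1 i := h.2
  rw [rowBlk_apply _ hi hl', Matrix.mul_apply]
  by_cases h' : l + 1 ≤ i
  · have hl₁ : l + 1 ∈ Set.Icc 1 i := ⟨by omega, h'⟩
    rw [rowBlk_apply _ hi hl₁, Finset.sum_eq_single ⟨⟨i, hi⟩, ⟨l + 1, hl₁⟩, y⟩]
    · simp [jordanN]
    · rintro ⟨⟨j, hj⟩, ⟨m, hm⟩, z⟩ - hne
      simp only [jordanN, of_apply]
      rw [if_neg, zero_mul]
      rintro ⟨h1 : i = j, h2 : m = l + 1, h3⟩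
      apply hne
      subst h1 h2
      simp [Fin.ext_iff, h3]
    · simp
  · rw [rowBlk_void _ (by omega)]
    refine Finset.sum_eq_zero ?_
    rintro ⟨⟨j, hj⟩, ⟨m, hm⟩, z⟩ -
    simp only [jordanN, of_apply]
    rw [if_neg, zero_mul]
    rintro ⟨h1 : i = j, h2 : m = l + 1, -⟩
    have : m ≤ j := hm.2
    omega

/-- Passing to sums over natural numbers allows single blocks to be split off without handling
subtypes. -/
theorem sum_tIdx {M : Type*} [AddCommMonoid M] (a : ℕ) (f : (j : ℕ) → Fin (s j) → M) :
    ∑ p : TIdx a k s, f p.1 p.2 = ∑ j ∈ Finset.Icc a k, ∑ y, f j y := by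
  rw [Fintype.sum_sigma, ← Finset.sum_coe_sort (Finset.Icc a k)]
  refine Fintype.sum_equiv (Equiv.subtypeEquivRight (by simp)) _ _ ?_
  rintro ⟨j, hj⟩
  rfl

theorem colsFrom_mul (Xi : Matrix ι (JIdx k s) ℂ) (a m : ℕ) (T : Matrix (TIdx a k s) κ ℂ) :
    colsFrom Xi a m * T = ∑ j ∈ Finset.Icc a k, colBlk Xi j m * tBlk T j := by
  ext u c
  rw [Matrix.mul_apply, Matrix.sum_apply]
  simp only [Matrix.mul_apply]
  rw [← sum_tIdx a fun j y => colBlk Xi j m u y * tBlk T j y c]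
  refine Finset.sum_congr rfl fun p _ => ?_
  have h : a ≤ (p.1 : ℕ) ∧ (p.1 : ℕ) ≤ k := p.1.2
  simp [colsFrom, tBlk, h]

theorem tBlk_rowsFrom (x : Matrix (JIdx k s) κ ℂ) {a j : ℕ} (m : ℕ) (h : a ≤ j) :
    tBlk (rowsFrom x a m) j = rowBlk x j m := by
  ext y c
  by_cases h' : j ≤ k
  · simp [tBlk, rowsFrom, colsFrom, rowBlk, h, h']
  · rw [rowBlk_void _ (by omega)]
    simp [tBlk, h']

theorem colsFrom_mul_rowsFrom (Xi : Matrix ι (JIdx k s) ℂ) (x : Matrix (JIdx k s) κ ℂ)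
    (a m m' : ℕ) : colsFrom Xi a m * rowsFrom x a m'
      = ∑ j ∈ Finset.Icc a k, colBlk Xi j m * rowBlk x j m' := by
  rw [colsFrom_mul]
  refine Finset.sum_congr rfl fun j hj => ?_
  rw [tBlk_rowsFrom _ _ (Finset.mem_Icc.1 hj).1]

theorem colBlk_apply (Xi : Matrix ι (JIdx k s) ℂ) {i l : ℕ} (hi : i ∈ Set.Icc 1 k)
    (hl : l ∈ Set.Icc 1 i) (y : Fin (s i)) (c : ι) :
    colBlk Xi i l c y = Xi c ⟨⟨i, hi⟩, ⟨l, hl⟩, y⟩ := rowBlk_apply Xiᵀ hi hl y c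

theorem mul_lvl_mul (Xi : Matrix ι (JIdx k s) ℂ) (x : Matrix (JIdx k s) κ ℂ) (m : ℕ) :
    Xi * (lvl k s m * x) = ∑ j ∈ Finset.Icc 1 k, colBlk Xi j m * rowBlk x j m := by
  ext u c
  rw [Matrix.mul_apply, Matrix.sum_apply]
  simp only [Matrix.mul_apply (M := colBlk _ _ _)]
  rw [← sum_tIdx 1 fun j y => colBlk Xi j m u y * rowBlk x j m y c, Fintype.sum_sigma,
    Fintype.sum_sigma]
  refine Finset.sum_congr rfl fun ⟨j, hj⟩ _ => ?_
  rw [Fintype.sum_prod_type, Finset.sum_comm]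
  refine Finset.sum_congr rfl fun y _ => ?_
  simp only [lvl, lev, diagonal_mul]
  by_cases hm : m ∈ Set.Icc 1 j
  · rw [Finset.sum_eq_single ⟨m, hm⟩]
    · rw [colBlk_apply Xi hj hm, rowBlk_apply x hj hm]
      simp
    · rintro ⟨l, hl⟩ - hne
      have : l ≠ m := fun h => hne (Subtype.ext h)
      simp [this]
    · simp
  · rw [rowBlk_void x fun h => hm h.2]
    simp only [Matrix.zero_apply, mul_zero]
    refine Finset.sum_eq_zero fun l _ => ?_
    have : (l : ℕ) ≠ m := fun h => hm (h ▸ l.2)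
    simp [this]

theorem tBlk_stack_self {a i b : ℕ} (X : Matrix (Fin (s i)) κ ℂ) (Y : Matrix (TIdx b k s) κ ℂ)
    (ha : a ≤ i) (hk : i ≤ k) : tBlk (stack a i b X Y) i = X := by
  ext y c
  simp [tBlk, stack, ha, hk]

theorem tBlk_stack_of_ge {a i b j : ℕ} (X : Matrix (Fin (s i)) κ ℂ)
    (Y : Matrix (TIdx b k s) κ ℂ) (ha : a ≤ i) (hb : i < b) (hj : b ≤ j) :
    tBlk (stack a i b X Y) j = tBlk Y j := by
  ext y c
  have h1 : a ≤ j := by omega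
  have h2 : j ≠ i := by omega
  by_cases hk : j ≤ k <;> simp [tBlk, stack, h1, h2, hk, hj]

theorem tBlk_stack_of_lt {a i b j : ℕ} (X : Matrix (Fin (s i)) κ ℂ)
    (Y : Matrix (TIdx b k s) κ ℂ) (hi : j ≠ i) (hj : j < b) :
    tBlk (stack a i b X Y) j = 0 := by
  ext y c
  have h1 : ¬ b ≤ j := by omega
  simp [tBlk, stack, h1, hi]

theorem colsFrom_mul_stack (Xi : Matrix ι (JIdx k s) ℂ) (m : ℕ) {a i b : ℕ}
    (X : Matrix (Fin (s i)) κ ℂ) (Y : Matrix (TIdx b k s) κ ℂ) (ha : a ≤ i) (hb : i < b)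
    (hk : i ≤ k) :
    colsFrom Xi a m * stack a i b X Y = colBlk Xi i m * X + colsFrom Xi b m * Y := by
  rw [colsFrom_mul, colsFrom_mul, ← Finset.add_sum_erase (a := i) _ _ (by simp; omega),
    tBlk_stack_self X Y ha hk]
  congr 1
  symm
  refine Finset.sum_subset_zero_on_sdiff ?_ ?_ ?_
  · intro j hj
    simp only [Finset.mem_erase, Finset.mem_Icc] at hj ⊢
    omega
  · intro j hj
    simp only [Finset.mem_sdiff, Finset.mem_erase, Finset.mem_Icc] at hj
    rw [tBlk_stack_of_lt _ _ hj.1.1 (by omega), Matrix.mul_zero]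
  · intro j hj
    simp only [Finset.mem_Icc] at hj
    rw [tBlk_stack_of_ge _ _ ha hb hj.1]

/-- Every vector met below is supported on the blocks `ρ - 1`, `ρ` and beyond, and these three
groups play different roles in the elimination. -/
theorem mul_lvl_mul_of_vanish {ρ : ℕ} (hρ : 2 ≤ ρ) (hρk : ρ ≤ k) (Xi : Matrix ι (JIdx k s) ℂ)
    (x : Matrix (JIdx k s) κ ℂ) (m : ℕ) (h : ∀ j, 1 ≤ j → j < ρ - 1 → rowBlk x j m = 0) :
    Xi * (lvl k s m * x) = colBlk Xi (ρ - 1) m * rowBlk x (ρ - 1) m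
      + colBlk Xi ρ m * rowBlk x ρ m + colsFrom Xi (ρ + 1) m * rowsFrom x (ρ + 1) m := by
  rw [mul_lvl_mul, colsFrom_mul_rowsFrom,
    ← Finset.add_sum_erase (a := ρ - 1) _ _ (by simp; omega),
    ← Finset.add_sum_erase (a := ρ) _ _ (by simp; omega), add_assoc]
  congr 2
  symm
  refine Finset.sum_subset_zero_on_sdiff ?_ ?_ fun _ _ => rfl
  · intro j hj
    simp only [Finset.mem_erase, Finset.mem_Icc] at hj ⊢
    omega
  · intro j hj
    simp only [Finset.mem_sdiff, Finset.mem_erase, Finset.mem_Icc] at hj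
    rw [h j (by omega) (by omega), Matrix.mul_zero]

theorem rowBlk_colBlk (B : Matrix (JIdx k s) (JIdx k s) ℂ) (i j l m : ℕ) :
    rowBlk (colBlk B j m) i l = blk B i j l m := rfl

theorem rowBlk_colsFrom (B : Matrix (JIdx k s) (JIdx k s) ℂ) (i j l m : ℕ) :
    rowBlk (colsFrom B j m) i l = blkRow B i j l m := rfl

theorem blkRow_mul_stack (B : Matrix (JIdx k s) (JIdx k s) ℂ) (i₀ l m : ℕ) {a i b : ℕ}
    (X : Matrix (Fin (s i)) κ ℂ) (Y : Matrix (TIdx b k s) κ ℂ) (ha : a ≤ i) (hb : i < b)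
    (hk : i ≤ k) :
    blkRow B i₀ a l m * stack a i b X Y = blk B i₀ i l m * X + blkRow B i₀ b l m * Y := by
  rw [← rowBlk_colsFrom, ← rowBlk_mul, colsFrom_mul_stack B m X Y ha hb hk, rowBlk_add,
    rowBlk_mul, rowBlk_mul, rowBlk_colBlk, rowBlk_colsFrom]

theorem rowBlk_mul_lvl_mul_of_vanish {ρ : ℕ} (hρ : 2 ≤ ρ) (hρk : ρ ≤ k)
    (B : Matrix (JIdx k s) (JIdx k s) ℂ) (x : Matrix (JIdx k s) κ ℂ) (m : ℕ)
    (h : ∀ j, 1 ≤ j → j < ρ - 1 → rowBlk x j m = 0) (i l : ℕ) :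
    rowBlk (B * (lvl k s m * x)) i l = blk B i (ρ - 1) l m * rowBlk x (ρ - 1) m
      + blk B i ρ l m * rowBlk x ρ m + blkRow B i (ρ + 1) l m * rowsFrom x (ρ + 1) m := by
  rw [mul_lvl_mul_of_vanish hρ hρk B x m h, rowBlk_add, rowBlk_add, rowBlk_mul, rowBlk_mul,
    rowBlk_mul, rowBlk_colBlk, rowBlk_colBlk, rowBlk_colsFrom]

theorem W_mul_apply (B : Matrix (JIdx k s) (JIdx k s) ℂ) (i : ℕ) (T : Matrix (TIdx i k s) κ ℂ)
    (p : TIdx i k s) (c : κ) : (W B i * T) p c = (blkRow B p.1 i p.1 1 * T) p.2 c := rfl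

end blocks

/-! ### Homogeneous Sylvester equations -/

theorem aeval_mul_of_intertwine {m n : Type*} [Fintype m] [Fintype n] [DecidableEq m]
    [DecidableEq n] {M : Matrix m m ℂ} {N : Matrix n n ℂ} {Y : Matrix m n ℂ} (h : M * Y = Y * N)
    (p : Polynomial ℂ) : Polynomial.aeval M p * Y = Y * Polynomial.aeval N p := by
  have hpow : ∀ e : ℕ, M ^ e * Y = Y * N ^ e := by
    intro e
    induction e with
    | zero => simp
    | succ e ih => rw [pow_succ, pow_succ, Matrix.mul_assoc, h, ← Matrix.mul_assoc, ih,
        Matrix.mul_assoc]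
  induction p using Polynomial.induction_on' with
  | add p q hp hq => rw [map_add, map_add, Matrix.add_mul, Matrix.mul_add, hp, hq]
  | monomial e a =>
    rw [Polynomial.aeval_monomial, Polynomial.aeval_monomial, Algebra.algebraMap_eq_smul_one,
      Algebra.algebraMap_eq_smul_one, smul_mul_assoc, smul_mul_assoc, one_mul, one_mul,
      Matrix.smul_mul, Matrix.mul_smul, hpow]

/-- The homogeneous Sylvester equation with disjoint spectra has only the zero solution. -/
theorem eq_zero_of_intertwine {m n : Type*} [Fintype m] [Fintype n] [DecidableEq m]
    [DecidableEq n] {M : Matrix m m ℂ} {N : Matrix n n ℂ} {Y : Matrix m n ℂ}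
    (hd : Disjoint (spectrum ℂ M) (spectrum ℂ N)) (h : M * Y = Y * N) : Y = 0 := by
  cases isEmpty_or_nonempty n with
  | inl hn => ext i j; exact hn.elim j
  | inr hn =>
    -- With `p` the characteristic polynomial of `N`, the eigenvalues of `p(M)` are the values of
    -- `p` on the spectrum of `M`, none of them zero. Cayley–Hamilton then makes `p(M) Y = Y p(N)`
    -- read `p(M) Y = 0`. Nonemptiness of `n` ensures positive degree.
    have h0 : (0 : ℂ) ∉ spectrum ℂ (Polynomial.aeval M N.charpoly) := by
      rw [spectrum.map_polynomial_aeval_of_degree_pos M N.charpoly (by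
        rw [charpoly_degree_eq_dim]; exact_mod_cast Fintype.card_pos)]
      rintro ⟨μ, hμ, hr⟩
      exact Set.disjoint_left.1 hd hμ (Matrix.mem_spectrum_iff_isRoot_charpoly.2 hr)
    have hu : IsUnit (Polynomial.aeval M N.charpoly) := spectrum.zero_notMem_iff ℂ |>.1 h0
    have h1 := aeval_mul_of_intertwine h N.charpoly
    rw [aeval_self_charpoly, Matrix.mul_zero] at h1
    obtain ⟨u, hu⟩ := hu
    rw [← hu] at h1
    calc Y = (↑u⁻¹ * ↑u : Matrix m m ℂ) * Y := by simp
      _ = 0 := by rw [Matrix.mul_assoc, h1, Matrix.mul_zero]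

/-! ### Invariant subspaces of `Θ_ρ` and their dual rows -/

section spectral

variable {ρ r r' : ℕ} {κ : Type*}

/-- The sub-block `l < ρ` (counted from `0`) of the rows of `φ`. -/
def fBlk {m : ℕ} (φ : Matrix (Fin ρ × Fin m) κ ℂ) (l : ℕ) : Matrix (Fin m) κ ℂ :=
  Matrix.of fun y c => if h : l < ρ then φ (⟨l, h⟩, y) c else 0

theorem fBlk_apply {m : ℕ} (φ : Matrix (Fin ρ × Fin m) κ ℂ) (l : Fin ρ) (y : Fin m) (c : κ) :
    fBlk φ l y c = φ (l, y) c := by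
  simp [fBlk]

theorem fBlk_ext {m : ℕ} {φ ψ : Matrix (Fin ρ × Fin m) κ ℂ}
    (h : ∀ l < ρ, fBlk φ l = fBlk ψ l) : φ = ψ := by
  ext ⟨l, y⟩ c
  rw [← fBlk_apply φ, ← fBlk_apply ψ, h l l.2]

theorem fBlk_mul {m : ℕ} {κ' : Type*} [Fintype κ] (φ : Matrix (Fin ρ × Fin m) κ ℂ)
    (X : Matrix κ κ' ℂ) (l : ℕ) : fBlk (φ * X) l = fBlk φ l * X := by
  ext y c
  simp only [fBlk, of_apply, Matrix.mul_apply]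
  split_ifs <;> simp

theorem fBlk_sub {m : ℕ} (φ ψ : Matrix (Fin ρ × Fin m) κ ℂ) (l : ℕ) :
    fBlk (φ - ψ) l = fBlk φ l - fBlk ψ l := by
  ext y c
  simp only [fBlk, of_apply, Matrix.sub_apply]
  split_ifs <;> simp

theorem fBlk_Theta_mul_of_lt (B : Matrix (JIdx k s) (JIdx k s) ℂ)
    (φ : Matrix (Fin ρ × Fin (s ρ)) κ ℂ) {l : ℕ} (hl : l + 1 < ρ) :
    fBlk (Theta B ρ * φ) l = fBlk φ (l + 1) := by
  ext y c
  have hl' : l < ρ := by omega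
  simp only [fBlk, of_apply, hl, hl', dite_true, Matrix.mul_apply]
  rw [Finset.sum_eq_single (⟨l + 1, hl⟩, y)]
  · simp [Theta]
  · rintro ⟨m, z⟩ - hne
    have h1 : l + 1 ≠ ρ := by omega
    by_cases hm : (m : ℕ) = l + 1
    · have hz : y ≠ z := by
        rintro rfl
        exact hne (Prod.ext (Fin.ext hm) rfl)
      simp [Theta, hm, hz]
    · simp [Theta, hm, h1]
  · simp

theorem fBlk_Theta_mul_last (B : Matrix (JIdx k s) (JIdx k s) ℂ)
    (φ : Matrix (Fin ρ × Fin (s ρ)) κ ℂ) (hρ : 0 < ρ) :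
    fBlk (Theta B ρ * φ) (ρ - 1) = S B ρ * fBlk φ 0 := by
  ext y c
  have hl' : ρ - 1 < ρ := by omega
  simp only [fBlk, of_apply, hρ, hl', dite_true, Matrix.mul_apply]
  rw [Fintype.sum_prod_type, Finset.sum_eq_single ⟨0, hρ⟩]
  · refine Finset.sum_congr rfl fun z _ => ?_
    have h1 : ρ - 1 + 1 = ρ := by omega
    have h2 : ¬ 0 = ρ := by omega
    simp [Theta, h1, h2]
  · rintro m - hne
    have h1 : (m : ℕ) ≠ 0 := fun h => hne (Fin.ext h)
    have h2 : (m : ℕ) ≠ ρ - 1 + 1 := by have := m.2; omega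
    simp [Theta, h1, h2]
  · simp

/-- The superdiagonal identities of `Θ` act as a shift, so an invariant subspace is determined by
its top block, as for a companion matrix. -/
theorem fBlk_of_intertwine (B : Matrix (JIdx k s) (JIdx k s) ℂ)
    {Φ : Matrix (Fin ρ × Fin (s ρ)) (Fin r) ℂ} {Ω : Matrix (Fin r) (Fin r) ℂ}
    (hΦ : Theta B ρ * Φ = Φ * Ω) {l : ℕ} (hl : l < ρ) : fBlk Φ l = fBlk Φ 0 * Ω ^ l := by
  induction l with
  | zero => simp
  | succ l ih =>
    rw [← fBlk_Theta_mul_of_lt B Φ hl, hΦ, fBlk_mul, ih (by omega), pow_succ, Matrix.mul_assoc]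

theorem S_mul_of_intertwine (B : Matrix (JIdx k s) (JIdx k s) ℂ) (hρ : 0 < ρ)
    {Φ : Matrix (Fin ρ × Fin (s ρ)) (Fin r) ℂ} {Ω : Matrix (Fin r) (Fin r) ℂ}
    (hΦ : Theta B ρ * Φ = Φ * Ω) : S B ρ * fBlk Φ 0 = fBlk Φ 0 * Ω ^ ρ := by
  rw [← fBlk_Theta_mul_last B Φ hρ, hΦ, fBlk_mul, fBlk_of_intertwine B hΦ (by omega),
    Matrix.mul_assoc, ← pow_succ, Nat.sub_add_cancel hρ]

/-- The block row `[Ω^{ρ-1} Q̃, …, Ω Q̃, Q̃]`. -/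
def leftRow {m : ℕ} (ρ : ℕ) (Ω : Matrix (Fin r) (Fin r) ℂ) (Qt : Matrix (Fin r) (Fin m) ℂ) :
    Matrix (Fin r) (Fin ρ × Fin m) ℂ :=
  Matrix.of fun i p => (Ω ^ (ρ - 1 - p.1) * Qt) i p.2

theorem leftRow_mul {m : ℕ} (Ω : Matrix (Fin r) (Fin r) ℂ) (Qt : Matrix (Fin r) (Fin m) ℂ)
    (φ : Matrix (Fin ρ × Fin m) κ ℂ) :
    leftRow ρ Ω Qt * φ = ∑ l ∈ Finset.range ρ, Ω ^ (ρ - 1 - l) * Qt * fBlk φ l := by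
  ext i c
  rw [Matrix.mul_apply, Matrix.sum_apply, Fintype.sum_prod_type,
    ← Fin.sum_univ_eq_sum_range fun l => (Ω ^ (ρ - 1 - l) * Qt * fBlk φ l) i c]
  refine Finset.sum_congr rfl fun l _ => ?_
  rw [Matrix.mul_apply]
  refine Finset.sum_congr rfl fun y _ => ?_
  rw [fBlk_apply]
  rfl

/-- Left companion structure: `Θ` shifts the powers of `Ω`, and the power `Ω ^ ρ` that falls off the
end is reabsorbed through the corner `S` by the solvent equation. -/
theorem leftRow_mul_Theta_mul (B : Matrix (JIdx k s) (JIdx k s) ℂ) (hρ : 0 < ρ)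
    {Ω : Matrix (Fin r) (Fin r) ℂ} {Qt : Matrix (Fin r) (Fin (s ρ)) ℂ}
    (hQt : Qt * S B ρ = Ω ^ ρ * Qt) (φ : Matrix (Fin ρ × Fin (s ρ)) κ ℂ) :
    leftRow ρ Ω Qt * (Theta B ρ * φ) = Ω * (leftRow ρ Ω Qt * φ) := by
  rw [leftRow_mul, leftRow_mul]
  obtain ⟨n, hn⟩ : ∃ n, ρ = n + 1 := ⟨ρ - 1, by omega⟩
  have hrange : Finset.range ρ = Finset.range (n + 1) := by rw [hn]
  rw [hrange, Finset.sum_range_succ, Finset.sum_range_succ', Matrix.mul_add, Matrix.mul_sum]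
  congr 1
  · refine Finset.sum_congr rfl fun l hl => ?_
    have hl := Finset.mem_range.1 hl
    rw [fBlk_Theta_mul_of_lt B φ (by omega), ← Matrix.mul_assoc, ← Matrix.mul_assoc, ← pow_succ']
    congr 3
    omega
  · have h1 : fBlk (Theta B ρ * φ) n = S B ρ * fBlk φ 0 := by
      rw [← fBlk_Theta_mul_last B φ hρ]
      congr 1
      omega
    have h2 : ρ - 1 - n = 0 := by omega
    rw [h1, h2, pow_zero, Matrix.one_mul, ← Matrix.mul_assoc, hQt, ← Matrix.mul_assoc,
      ← Matrix.mul_assoc, ← pow_succ']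
    congr 3
    omega

/-- The rows of `[Φ Φ_c]⁻¹` dual to `Φ`, in terms of a left solvent. -/
theorem leftRow_eq (B : Matrix (JIdx k s) (JIdx k s) ℂ) (hρ : 0 < ρ)
    {Φ : Matrix (Fin ρ × Fin (s ρ)) (Fin r) ℂ} {Φc : Matrix (Fin ρ × Fin (s ρ)) (Fin r') ℂ}
    {Ω : Matrix (Fin r) (Fin r) ℂ} {Ωc : Matrix (Fin r') (Fin r') ℂ}
    (hΦ : Theta B ρ * Φ = Φ * Ω) (hΦc : Theta B ρ * Φc = Φc * Ωc)
    (hd : Disjoint (spectrum ℂ Ω) (spectrum ℂ Ωc))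
    {P₁ : Matrix (Fin r) (Fin ρ × Fin (s ρ)) ℂ} {P₂ : Matrix (Fin r') (Fin ρ × Fin (s ρ)) ℂ}
    (hP : Φ * P₁ + Φc * P₂ = 1) {Qt : Matrix (Fin r) (Fin (s ρ)) ℂ}
    (hQt : Qt * S B ρ = Ω ^ ρ * Qt) :
    leftRow ρ Ω Qt = Msum ρ Ω Qt (fBlk Φ 0) * P₁ := by
  have h1 : leftRow ρ Ω Qt * Φ = Msum ρ Ω Qt (fBlk Φ 0) := by
    rw [leftRow_mul, Msum]
    refine Finset.sum_congr rfl fun l hl => ?_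
    rw [fBlk_of_intertwine B hΦ (Finset.mem_range.1 hl), ← Matrix.mul_assoc]
  -- This product intertwines `Ω` and `Ωc`, whose spectra are disjoint.
  have h2 : leftRow ρ Ω Qt * Φc = 0 := by
    refine eq_zero_of_intertwine hd ?_
    rw [← leftRow_mul_Theta_mul B hρ hQt, hΦc, Matrix.mul_assoc]
  calc leftRow ρ Ω Qt = leftRow ρ Ω Qt * (Φ * P₁ + Φc * P₂) := by rw [hP, Matrix.mul_one]
    _ = _ := by
      rw [Matrix.mul_add, ← Matrix.mul_assoc, ← Matrix.mul_assoc, h1, h2, Matrix.zero_mul,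
        add_zero]

/-- The dual rows are `M` times the solvent row; a right-hand side living in the last two blocks
meets only its entries `Ω Q̃` and `Q̃`, which is the shape of `Δ`. -/
theorem dual_mul_eq (B : Matrix (JIdx k s) (JIdx k s) ℂ) (hρ : 2 ≤ ρ)
    {Φ : Matrix (Fin ρ × Fin (s ρ)) (Fin r) ℂ} {Φc : Matrix (Fin ρ × Fin (s ρ)) (Fin r') ℂ}
    {Ω : Matrix (Fin r) (Fin r) ℂ} {Ωc : Matrix (Fin r') (Fin r') ℂ}
    (hΦ : Theta B ρ * Φ = Φ * Ω) (hΦc : Theta B ρ * Φc = Φc * Ωc)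
    (hd : Disjoint (spectrum ℂ Ω) (spectrum ℂ Ωc))
    {P₁ : Matrix (Fin r) (Fin ρ × Fin (s ρ)) ℂ} {P₂ : Matrix (Fin r') (Fin ρ × Fin (s ρ)) ℂ}
    (hP : Φ * P₁ + Φc * P₂ = 1) {Qt : Matrix (Fin r) (Fin (s ρ)) ℂ}
    (hQt : Qt * S B ρ = Ω ^ ρ * Qt) (hM : IsUnit (Msum ρ Ω Qt (fBlk Φ 0)))
    (R : Matrix (Fin ρ × Fin (s ρ)) κ ℂ) (hR : ∀ l, l + 2 < ρ → fBlk R l = 0) :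
    P₁ * R = (Msum ρ Ω Qt (fBlk Φ 0))⁻¹
      * (Ω * Qt * fBlk R (ρ - 2) + Qt * fBlk R (ρ - 1)) := by
  have h1 : P₁ = (Msum ρ Ω Qt (fBlk Φ 0))⁻¹ * leftRow ρ Ω Qt := by
    rw [leftRow_eq B (by omega) hΦ hΦc hd hP hQt, ← Matrix.mul_assoc,
      Matrix.nonsing_inv_mul _ ((Matrix.isUnit_iff_isUnit_det _).1 hM), Matrix.one_mul]
  obtain ⟨n, hn⟩ : ∃ n, ρ = n + 2 := ⟨ρ - 2, by omega⟩
  have hrange : Finset.range ρ = Finset.range (n + 1 + 1) := by rw [hn]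
  rw [h1, Matrix.mul_assoc, leftRow_mul, hrange, Finset.sum_range_succ, Finset.sum_range_succ,
    Finset.sum_eq_zero fun l hl => ?_, zero_add]
  · have e1 : ρ - 1 - n = 1 := by omega
    have e2 : ρ - 1 - (n + 1) = 0 := by omega
    have e3 : ρ - 2 = n := by omega
    have e4 : ρ - 1 = n + 1 := by omega
    rw [e1, e2, e3, e4, pow_one, pow_zero, Matrix.one_mul]
  · have hl := Finset.mem_range.1 hl
    rw [hR l (by omega), Matrix.mul_zero]

/-- `Θ` is block diagonal in the basis `[Φ Φc]`, so the dual rows are left invariant. -/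
theorem dual_mul_Theta_mul (B : Matrix (JIdx k s) (JIdx k s) ℂ)
    {Φ : Matrix (Fin ρ × Fin (s ρ)) (Fin r) ℂ} {Φc : Matrix (Fin ρ × Fin (s ρ)) (Fin r') ℂ}
    {Ω : Matrix (Fin r) (Fin r) ℂ} {Ωc : Matrix (Fin r') (Fin r') ℂ}
    (hΦ : Theta B ρ * Φ = Φ * Ω) (hΦc : Theta B ρ * Φc = Φc * Ωc)
    {P₁ : Matrix (Fin r) (Fin ρ × Fin (s ρ)) ℂ} {P₂ : Matrix (Fin r') (Fin ρ × Fin (s ρ)) ℂ}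
    (hP : Φ * P₁ + Φc * P₂ = 1) (h₁ : P₁ * Φ = 1) (h₁c : P₁ * Φc = 0)
    (φ : Matrix (Fin ρ × Fin (s ρ)) κ ℂ) : P₁ * (Theta B ρ * φ) = Ω * (P₁ * φ) := by
  calc P₁ * (Theta B ρ * φ) = P₁ * (Theta B ρ * (Φ * P₁ + Φc * P₂)) * φ := by
        rw [hP, Matrix.mul_one, Matrix.mul_assoc]
    _ = ((P₁ * Φ) * Ω * P₁ + (P₁ * Φc) * Ωc * P₂) * φ := by
        rw [Matrix.mul_add, ← Matrix.mul_assoc (Theta B ρ), ← Matrix.mul_assoc (Theta B ρ), hΦ,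
          hΦc, Matrix.mul_add]
        simp only [Matrix.mul_assoc]
    _ = _ := by
        rw [h₁, h₁c, Matrix.one_mul, Matrix.zero_mul, Matrix.zero_mul, add_zero,
          Matrix.mul_assoc]

/-- If `Ω u = 0`, then `S Q u = Q Ω^ρ u = 0` gives `Q u = 0`; every block `Q Ω^l u` of `Φ u` then
vanishes, and `Φ` has a left inverse. -/
theorem isUnit_of_intertwine (B : Matrix (JIdx k s) (JIdx k s) ℂ) (hρ : 0 < ρ)
    (hS : IsUnit (S B ρ))
    {Φ : Matrix (Fin ρ × Fin (s ρ)) (Fin r) ℂ} {Ω : Matrix (Fin r) (Fin r) ℂ}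
    (hΦ : Theta B ρ * Φ = Φ * Ω) {P₁ : Matrix (Fin r) (Fin ρ × Fin (s ρ)) ℂ}
    (h₁ : P₁ * Φ = 1) : IsUnit Ω := by
  rw [← Matrix.mulVec_injective_iff_isUnit]
  refine (injective_iff_map_eq_zero Ω.mulVecLin).2 fun u hu => ?_
  have hu : Ω *ᵥ u = 0 := hu
  have hcol : Ω * replicateCol (Fin 1) u = 0 := by
    rw [← Matrix.replicateCol_mulVec, hu, Matrix.replicateCol_zero]
  have hpow : Ω ^ ρ = Ω ^ (ρ - 1) * Ω := by rw [← pow_succ, Nat.sub_add_cancel hρ]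
  have h0 : fBlk Φ 0 * replicateCol (Fin 1) u = 0 := by
    have : S B ρ * (fBlk Φ 0 * replicateCol (Fin 1) u) = 0 := by
      rw [← Matrix.mul_assoc, S_mul_of_intertwine B hρ hΦ, hpow,
        Matrix.mul_assoc, Matrix.mul_assoc, hcol, Matrix.mul_zero, Matrix.mul_zero]
    have hd := (Matrix.isUnit_iff_isUnit_det _).1 hS
    rw [← Matrix.one_mul (fBlk Φ 0 * _), ← Matrix.nonsing_inv_mul _ hd, Matrix.mul_assoc, this,
      Matrix.mul_zero]
  have hΦu : Φ * replicateCol (Fin 1) u = 0 := by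
    refine fBlk_ext fun l hl => ?_
    rw [fBlk_mul, fBlk_of_intertwine B hΦ hl]
    rcases l with _ | l
    · rw [pow_zero, Matrix.mul_one, h0]
      ext y c
      simp [fBlk]
    · rw [pow_succ, Matrix.mul_assoc, Matrix.mul_assoc, hcol, Matrix.mul_zero, Matrix.mul_zero]
      ext y c
      simp [fBlk]
  have : replicateCol (Fin 1) u = 0 := by
    rw [← Matrix.one_mul (replicateCol (Fin 1) u), ← h₁, Matrix.mul_assoc, hΦu, Matrix.mul_zero]
  ext i
  exact congrFun (congrFun this i) 0

end spectral

/-! ### Elimination of the large blocks by a Schur complement -/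

section schur

variable {κ κ' : Type*} {B : Matrix (JIdx k s) (JIdx k s) ℂ} {ρ : ℕ}

theorem tBlk_mul [Fintype κ] {a : ℕ} (T : Matrix (TIdx a k s) κ ℂ) (U : Matrix κ κ' ℂ) (j : ℕ) :
    tBlk (T * U) j = tBlk T j * U := by
  ext y c
  simp only [tBlk, of_apply, Matrix.mul_apply]
  split_ifs <;> simp

theorem tBlk_apply {a : ℕ} (T : Matrix (TIdx a k s) κ ℂ) (p : TIdx a k s) (c : κ) :
    tBlk T p.1 p.2 c = T p c := by
  have h : a ≤ (p.1 : ℕ) ∧ (p.1 : ℕ) ≤ k := p.1.2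
  simp [tBlk, h]

theorem Z_add_W_mul_G (hW : IsUnit (W B (ρ + 1))) (j : ℕ) :
    Z B (ρ + 1) j + W B (ρ + 1) * G B ρ j = 0 := by
  rw [G, Matrix.mul_neg, ← Matrix.mul_assoc,
    Matrix.mul_nonsing_inv _ ((Matrix.isUnit_iff_isUnit_det _).1 hW), Matrix.one_mul,
    add_neg_cancel]

theorem blkRow_mul_IG (hρk : ρ ≤ k) (i l : ℕ) : blkRow B i ρ l 1 * IG B ρ = Bhat B ρ i l := by
  rw [IG, blkRow_mul_stack B i l 1 _ _ le_rfl (Nat.lt_succ_self ρ) hρk, Matrix.mul_one, Bhat]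

theorem Bhat_diag_eq_zero (hW : IsUnit (W B (ρ + 1))) {i : ℕ} (hi : ρ < i) (hik : i ≤ k) :
    Bhat B ρ i i = 0 := by
  ext y c
  have hi' : i ∈ Set.Icc (ρ + 1) k := ⟨hi, hik⟩
  exact congrFun (congrFun (Z_add_W_mul_G hW ρ) ⟨⟨i, hi'⟩, y⟩) c

/-- `S` is the Schur complement of `W_{ρ+1}` in `W_ρ`: if `S u = 0`, then `W_ρ` annihilates `[u; G
u]`, whose top block is `u`. -/
theorem isUnit_S (hρk : ρ ≤ k) (hW : IsUnit (W B ρ)) (hW' : IsUnit (W B (ρ + 1))) :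
    IsUnit (S B ρ) := by
  rw [← Matrix.mulVec_injective_iff_isUnit]
  refine (injective_iff_map_eq_zero (S B ρ).mulVecLin).2 fun u hu => ?_
  have hu : S B ρ *ᵥ u = 0 := hu
  have hcol : S B ρ * replicateCol (Fin 1) u = 0 := by
    rw [← Matrix.replicateCol_mulVec, hu, Matrix.replicateCol_zero]
  have h0 : W B ρ * (IG B ρ * replicateCol (Fin 1) u) = 0 := by
    ext ⟨⟨j, hj⟩, y⟩ c
    rw [W_mul_apply]
    simp only
    rw [← Matrix.mul_assoc, blkRow_mul_IG hρk]
    obtain rfl | hlt := eq_or_lt_of_le hj.1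
    · exact congrFun (congrFun hcol y) c
    · rw [Bhat_diag_eq_zero hW' hlt hj.2, Matrix.zero_mul]
      rfl
  have h1 : IG B ρ * replicateCol (Fin 1) u = 0 := by
    rw [← Matrix.one_mul (IG B ρ * _),
      ← Matrix.nonsing_inv_mul _ ((Matrix.isUnit_iff_isUnit_det _).1 hW), Matrix.mul_assoc, h0,
      Matrix.mul_zero]
  have h2 : tBlk (IG B ρ * replicateCol (Fin 1) u) ρ = replicateCol (Fin 1) u := by
    rw [tBlk_mul, IG, tBlk_stack_self _ _ le_rfl hρk, Matrix.one_mul]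
  ext i
  have := congrFun (congrFun h2 i) 0
  rw [h1] at this
  simpa [tBlk] using this.symm

end schur

/-! ### The leading term -/

section lead

variable {r : ℕ} (B : Matrix (JIdx k s) (JIdx k s) ℂ) (ρ : ℕ)
  (Q : Matrix (Fin (s ρ)) (Fin r) ℂ) (Ω : Matrix (Fin r) (Fin r) ℂ)

/-- The blocks of the leading term of the scaled invariant subspace. -/
def leadBlk (i : ℕ) : ℕ → Matrix (Fin (s i)) (Fin r) ℂ
  | 0 => 0
  | 1 => tBlk (IG B ρ * Q) i
  | l + 2 => (if l + 1 ≤ ρ then leadBlk i (l + 1) * Ω else 0)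
      - (if ρ ≤ l + 1 then Bhat B ρ i (l + 1) * Q else 0)

/-- The leading term of the scaled invariant subspace. -/
def lead : Matrix (JIdx k s) (Fin r) ℂ :=
  Matrix.of fun p c => leadBlk B ρ Q Ω p.1 p.2.1 p.2.2 c

variable {B ρ Q Ω}

theorem rowBlk_lead {i l : ℕ} (hi : 1 ≤ i) (hik : i ≤ k) (hl : 1 ≤ l) (hli : l ≤ i) :
    rowBlk (lead B ρ Q Ω) i l = leadBlk B ρ Q Ω i l := by
  ext y c
  have hi' : i ∈ Set.Icc 1 k := ⟨hi, hik⟩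
  have hl' : l ∈ Set.Icc 1 i := ⟨hl, hli⟩
  rw [rowBlk_apply _ hi' hl']
  rfl

theorem leadBlk_succ {i l : ℕ} (hl : 1 ≤ l) : leadBlk B ρ Q Ω i (l + 1)
    = (if l ≤ ρ then leadBlk B ρ Q Ω i l * Ω else 0)
      - (if ρ ≤ l then Bhat B ρ i l * Q else 0) := by
  obtain ⟨l, rfl⟩ := Nat.exists_eq_add_of_le' hl
  rfl

theorem leadBlk_of_le (i : ℕ) {l : ℕ} (hl : l + 1 ≤ ρ) :
    leadBlk B ρ Q Ω i (l + 1) = tBlk (IG B ρ * Q) i * Ω ^ l := by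
  induction l with
  | zero => simp [leadBlk]
  | succ l ih =>
    rw [leadBlk_succ (by omega), if_pos (by omega), if_neg (by omega), ih (by omega), sub_zero,
      pow_succ, Matrix.mul_assoc]

/-- The column `IG` starts at block `ρ`, and in a smaller block only the geometric part of the
recursion is reached. -/
theorem rowBlk_lead_of_lt {i : ℕ} (hi : i < ρ) (l : ℕ) : rowBlk (lead B ρ Q Ω) i l = 0 := by
  by_cases h : (1 ≤ i ∧ i ≤ k) ∧ (1 ≤ l ∧ l ≤ i)
  · rw [rowBlk_lead h.1.1 h.1.2 h.2.1 h.2.2]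
    obtain ⟨l, rfl⟩ := Nat.exists_eq_add_of_le' h.2.1
    have ht : tBlk (IG B ρ * Q) i = 0 := by
      ext y c
      have : ¬ ρ ≤ i := by omega
      simp [tBlk, this]
    rw [leadBlk_of_le i (by omega), ht, Matrix.zero_mul]
  · exact rowBlk_void _ h

theorem tBlk_IG_self (hρk : ρ ≤ k) : tBlk (IG B ρ) ρ = 1 := by
  rw [IG, tBlk_stack_self _ _ le_rfl hρk]

theorem tBlk_IG_of_lt {i : ℕ} (hi : ρ < i) : tBlk (IG B ρ) i = tBlk (G B ρ ρ) i := by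
  rw [IG, tBlk_stack_of_ge _ _ le_rfl (Nat.lt_succ_self ρ) hi]

theorem rowBlk_lead_self (hρk : ρ ≤ k) {l : ℕ} (hl : l < ρ) :
    rowBlk (lead B ρ Q Ω) ρ (l + 1) = Q * Ω ^ l := by
  rw [rowBlk_lead (by omega) hρk (by omega) hl, leadBlk_of_le ρ hl, tBlk_mul, tBlk_IG_self hρk,
    Matrix.one_mul]

theorem rowsFrom_lead (m : ℕ) (hm : m + 1 ≤ ρ) :
    rowsFrom (lead B ρ Q Ω) (ρ + 1) (m + 1) = G B ρ ρ * Q * Ω ^ m := by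
  ext ⟨⟨i, hi⟩, y⟩ c
  have hi1 : ρ + 1 ≤ i := hi.1
  rw [← tBlk_apply (rowsFrom _ _ _), ← tBlk_apply (G B ρ ρ * Q * Ω ^ m)]
  simp only
  rw [tBlk_rowsFrom _ _ hi1, rowBlk_lead (by omega) hi.2 (by omega) (by omega),
    leadBlk_of_le i hm, tBlk_mul, tBlk_mul, tBlk_mul, tBlk_IG_of_lt hi1]

theorem rowBlk_mul_lvl_lead (hρ : 2 ≤ ρ) (hρk : ρ ≤ k) (i l m : ℕ) (hm : m + 1 ≤ ρ) :
    rowBlk (B * (lvl k s (m + 1) * lead B ρ Q Ω)) i l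
      = (blk B i ρ l (m + 1) + blkRow B i (ρ + 1) l (m + 1) * G B ρ ρ) * Q * Ω ^ m := by
  rw [rowBlk_mul_lvl_mul_of_vanish hρ hρk B _ _ fun j _ hj => rowBlk_lead_of_lt (by omega) _,
    rowBlk_lead_of_lt (by omega), rowBlk_lead_self hρk hm, rowsFrom_lead m hm, Matrix.mul_zero,
    zero_add]
  simp only [Matrix.add_mul, Matrix.mul_assoc]

theorem rowBlk_mul_lvl_one_lead (hρ : 2 ≤ ρ) (hρk : ρ ≤ k) (i l : ℕ) :
    rowBlk (B * (lvl k s 1 * lead B ρ Q Ω)) i l = Bhat B ρ i l * Q := by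
  rw [rowBlk_mul_lvl_lead (m := 0) hρ hρk i l (by omega), pow_zero, Matrix.mul_one, Bhat]

/-- The leading term solves the limit equation, block by block. -/
theorem lead_equation (hρ : 2 ≤ ρ) (hρk : ρ ≤ k) (hW' : IsUnit (W B (ρ + 1)))
    (hQ : S B ρ * Q = Q * Ω ^ ρ) {i l : ℕ} (hi : 1 ≤ i) (hik : i ≤ k) (hl : 1 ≤ l)
    (hli : l ≤ i) :
    rowBlk (lead B ρ Q Ω) i (l + 1)
      + (if ρ ≤ l then rowBlk (B * (lvl k s 1 * lead B ρ Q Ω)) i l else 0)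
      - (if l ≤ ρ then rowBlk (lead B ρ Q Ω) i l * Ω else 0) = 0 := by
  rw [rowBlk_mul_lvl_one_lead hρ hρk]
  -- Interior levels hold by the recursion that defines `leadBlk`. The last level is a genuine
  -- condition: trivial for `i < ρ`, the relation `S Q = Q Ω^ρ` for `i = ρ`, and the choice of `G`
  -- for `i > ρ`.
  rcases hli.lt_or_eq with hlt | rfl
  · rw [rowBlk_lead hi hik (by omega) hlt, leadBlk_succ hl, rowBlk_lead hi hik hl hli]
    abel
  · rw [rowBlk_void _ (by omega), zero_add]
    rcases lt_trichotomy l ρ with h | rfl | h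
    · rw [if_neg (by omega), if_pos h.le, rowBlk_lead_of_lt h, Matrix.zero_mul, sub_zero]
    · obtain ⟨m, hm⟩ : ∃ m, l = m + 1 := ⟨l - 1, by omega⟩
      have h1 : rowBlk (lead B l Q Ω) l l = Q * Ω ^ (l - 1) := by
        have := rowBlk_lead_self (B := B) (Q := Q) (Ω := Ω) hρk (l := l - 1) (by omega)
        rwa [Nat.sub_add_cancel hl] at this
      rw [if_pos le_rfl, if_pos le_rfl, h1, Matrix.mul_assoc, ← pow_succ, Nat.sub_add_cancel hl,
        ← hQ]
      exact sub_self _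
    · rw [if_pos h.le, if_neg (by omega), Bhat_diag_eq_zero hW' h hik, Matrix.zero_mul, sub_zero]

end lead

/-! ### The linearized equation -/

section linear

variable {r r' : ℕ} {B : Matrix (JIdx k s) (JIdx k s) ℂ} {ρ : ℕ}

/-- The linearized invariant subspace equation with right-hand side `e`, block by block. -/
def LinEq (B : Matrix (JIdx k s) (JIdx k s) ℂ) (ρ : ℕ) (a : Matrix (JIdx k s) (Fin r) ℂ)
    (Ω : Matrix (Fin r) (Fin r) ℂ) (x : Matrix (JIdx k s) (Fin r) ℂ)
    (X : Matrix (Fin r) (Fin r) ℂ) (e : (i : ℕ) → ℕ → Matrix (Fin (s i)) (Fin r) ℂ) : Prop :=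
  ∀ i l, 1 ≤ i → i ≤ k → 1 ≤ l → l ≤ i →
    rowBlk x i (l + 1) + (if ρ ≤ l then rowBlk (B * (lvl k s 1 * x)) i l else 0)
      - (if l ≤ ρ then rowBlk x i l * Ω + rowBlk a i l * X else 0) = e i l

/-- The sub-blocks of block `ρ`, as one block column. -/
def midBlk {κ : Type*} (ρ : ℕ) (x : Matrix (JIdx k s) κ ℂ) : Matrix (Fin ρ × Fin (s ρ)) κ ℂ :=
  Matrix.of fun p c => rowBlk x ρ (p.1 + 1) p.2 c

theorem midBlk_mul {κ κ' : Type*} [Fintype κ] (x : Matrix (JIdx k s) κ ℂ) (y : Matrix κ κ' ℂ) :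
    midBlk ρ (x * y) = midBlk ρ x * y := by
  ext p c
  simp only [midBlk, of_apply, rowBlk_mul]
  rfl

theorem fBlk_midBlk (x : Matrix (JIdx k s) (Fin r) ℂ) {l : ℕ} (hl : l < ρ) :
    fBlk (midBlk ρ x) l = rowBlk x ρ (l + 1) := by
  ext y c
  simp [fBlk, midBlk, hl]

variable {Q : Matrix (Fin (s ρ)) (Fin r) ℂ} {Ω : Matrix (Fin r) (Fin r) ℂ}
  {x : Matrix (JIdx k s) (Fin r) ℂ} {X : Matrix (Fin r) (Fin r) ℂ}
  {e : (i : ℕ) → ℕ → Matrix (Fin (s i)) (Fin r) ℂ}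

/-- In blocks smaller than `ρ` neither the perturbation nor the leading term contributes, so the
levels form a geometric chain. -/
theorem LinEq.rowBlk_small (h : LinEq B ρ (lead B ρ Q Ω) Ω x X e) {i : ℕ} (hi : i < ρ)
    (hi1 : 1 ≤ i) (hik : i ≤ k) (he : ∀ l, 1 ≤ l → l < i → e i l = 0) {l : ℕ} (hl : l < i) :
    rowBlk x i (l + 1) = rowBlk x i 1 * Ω ^ l := by
  induction l with
  | zero => simp
  | succ l ih =>
    have h1 := h i (l + 1) hi1 hik (by omega) hl.le
    rw [he _ (by omega) hl, if_neg (by omega), if_pos (by omega), rowBlk_lead_of_lt hi,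
      Matrix.zero_mul, add_zero, add_zero, sub_eq_zero, ih (by omega), Matrix.mul_assoc,
      ← pow_succ] at h1
    exact h1

theorem LinEq.rowBlk_small_last (h : LinEq B ρ (lead B ρ Q Ω) Ω x X e) {i : ℕ} (hi : i < ρ)
    (hi1 : 1 ≤ i) (hik : i ≤ k) (he : ∀ l, 1 ≤ l → l < i → e i l = 0) :
    rowBlk x i 1 * Ω ^ i = -e i i := by
  have h1 := h i i hi1 hik hi1 le_rfl
  have h2 := h.rowBlk_small hi hi1 hik he (l := i - 1) (by omega)
  rw [Nat.sub_add_cancel hi1] at h2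
  rw [rowBlk_void _ (by omega), if_neg (by omega), if_pos (by omega), rowBlk_lead_of_lt hi,
    Matrix.zero_mul, add_zero, add_zero, zero_sub, h2, Matrix.mul_assoc, ← pow_succ,
    Nat.sub_add_cancel hi1] at h1
  rw [← h1, neg_neg]

/-- The last level closes the chain as `x_{i1} Ω^i = 0`, and `Ω` is invertible. -/
theorem LinEq.rowBlk_small_eq_zero (h : LinEq B ρ (lead B ρ Q Ω) Ω x X e) (hΩ : IsUnit Ω)
    {i : ℕ} (hi : i < ρ) (he : ∀ l, 1 ≤ l → l ≤ i → e i l = 0) (l : ℕ) : rowBlk x i l = 0 := by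
  by_cases hv : (1 ≤ i ∧ i ≤ k) ∧ (1 ≤ l ∧ l ≤ i)
  swap
  · exact rowBlk_void _ hv
  have he' : ∀ l, 1 ≤ l → l < i → e i l = 0 := fun l h1 h2 => he l h1 h2.le
  have h1 := h.rowBlk_small_last hi hv.1.1 hv.1.2 he'
  rw [he i hv.1.1 le_rfl, neg_zero] at h1
  have h2 := h.rowBlk_small hi hv.1.1 hv.1.2 he' (l := l - 1) (by omega)
  have h3 : rowBlk x i 1 = 0 := by
    rw [← Matrix.mul_one (rowBlk x i 1),
      ← Matrix.mul_nonsing_inv _ ((Matrix.isUnit_iff_isUnit_det _).1 (hΩ.pow i)),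
      ← Matrix.mul_assoc, h1, Matrix.zero_mul]
  rw [Nat.sub_add_cancel hv.2.1, h3, Matrix.zero_mul] at h2
  exact h2

/-- The right-hand sides of the last equations of the blocks `ρ + 1, …, k`. -/
def bigRhs (k ρ : ℕ) (e : (i : ℕ) → ℕ → Matrix (Fin (s i)) (Fin r) ℂ) :
    Matrix (TIdx (ρ + 1) k s) (Fin r) ℂ :=
  Matrix.of fun p c => e p.1 p.1 p.2 c

/-- The last levels of the blocks beyond `ρ` contain only perturbation terms; solving them with
`W_{ρ+1}` expresses the level-one parts through those of blocks `ρ - 1` and `ρ`. -/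
theorem LinEq.rowsFrom_eq (h : LinEq B ρ (lead B ρ Q Ω) Ω x X e) (hρ : 2 ≤ ρ) (hρk : ρ ≤ k)
    (hW' : IsUnit (W B (ρ + 1))) (hx : ∀ i < ρ - 1, ∀ l, rowBlk x i l = 0) :
    rowsFrom x (ρ + 1) 1 = (W B (ρ + 1))⁻¹ * bigRhs k ρ e
      + G B ρ (ρ - 1) * rowBlk x (ρ - 1) 1 + G B ρ ρ * rowBlk x ρ 1 := by
  have h1 : Z B (ρ + 1) (ρ - 1) * rowBlk x (ρ - 1) 1 + Z B (ρ + 1) ρ * rowBlk x ρ 1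
      + W B (ρ + 1) * rowsFrom x (ρ + 1) 1 = bigRhs k ρ e := by
    ext ⟨⟨i, hi⟩, y⟩ c
    have hi1 : ρ + 1 ≤ i := hi.1
    have h2 := h i i (by omega) hi.2 (by omega) le_rfl
    rw [rowBlk_void _ (by omega), if_pos (by omega), if_neg (by omega), zero_add, sub_zero,
      rowBlk_mul_lvl_mul_of_vanish hρ hρk B x 1 fun j _ hj => hx j hj 1] at h2
    exact congrFun (congrFun h2 y) c
  have hd := (Matrix.isUnit_iff_isUnit_det _).1 hW'
  rw [← h1, G, G, Matrix.mul_add, Matrix.mul_add, ← Matrix.mul_assoc _ (W B (ρ + 1)),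
    Matrix.nonsing_inv_mul _ hd, Matrix.one_mul, Matrix.neg_mul, Matrix.neg_mul,
    Matrix.mul_assoc, Matrix.mul_assoc]
  abel

/-- The equations of block `ρ` assemble into the single relation `Θ φ - φ Ω - Φ X = R`; these are
its rows above the last. -/
theorem LinEq.fBlk_mid_of_lt (h : LinEq B ρ (lead B ρ Q Ω) Ω x X e) (hρk : ρ ≤ k)
    {Φ : Matrix (Fin ρ × Fin (s ρ)) (Fin r) ℂ} (hΦ : ∀ l < ρ, fBlk Φ l = Q * Ω ^ l)
    {l : ℕ} (hl : l + 1 < ρ) :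
    fBlk (Theta B ρ * midBlk ρ x - midBlk ρ x * Ω - Φ * X) l = e ρ (l + 1) := by
  have h1 := h ρ (l + 1) (by omega) hρk (by omega) hl.le
  rw [if_neg (by omega), if_pos hl.le, rowBlk_lead_self hρk (by omega), add_zero] at h1
  rw [fBlk_sub, fBlk_sub, fBlk_Theta_mul_of_lt B _ hl, fBlk_mul, fBlk_mul, fBlk_midBlk x hl,
    fBlk_midBlk x (by omega), hΦ l (by omega), ← h1]
  abel

/-- Eliminating the larger blocks turns the coefficient `B^{(ρρ)}_{ρ1}` into `S`, the corner of `Θ`;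
the leftover terms move to the right-hand side. -/
theorem LinEq.fBlk_mid_last (h : LinEq B ρ (lead B ρ Q Ω) Ω x X e) (hρ : 2 ≤ ρ) (hρk : ρ ≤ k)
    (hW' : IsUnit (W B (ρ + 1))) (hx : ∀ i < ρ - 1, ∀ l, rowBlk x i l = 0)
    {Φ : Matrix (Fin ρ × Fin (s ρ)) (Fin r) ℂ} (hΦ : ∀ l < ρ, fBlk Φ l = Q * Ω ^ l) :
    fBlk (Theta B ρ * midBlk ρ x - midBlk ρ x * Ω - Φ * X) (ρ - 1) = e ρ ρ
      - (blk B ρ (ρ - 1) ρ 1 * rowBlk x (ρ - 1) 1 + blkRow B ρ (ρ + 1) ρ 1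
          * ((W B (ρ + 1))⁻¹ * bigRhs k ρ e + G B ρ (ρ - 1) * rowBlk x (ρ - 1) 1)) := by
  have h1 := h ρ ρ (by omega) hρk (by omega) le_rfl
  have h2 := rowBlk_lead_self (B := B) (Q := Q) (Ω := Ω) hρk (l := ρ - 1) (by omega)
  have h3 := fBlk_midBlk (ρ := ρ) x (l := ρ - 1) (by omega)
  rw [Nat.sub_add_cancel (by omega : 1 ≤ ρ)] at h2 h3
  rw [rowBlk_void x (by omega), if_pos le_rfl, if_pos le_rfl, h2, zero_add,
    rowBlk_mul_lvl_mul_of_vanish hρ hρk B x 1 fun j _ hj => hx j hj 1,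
    h.rowsFrom_eq hρ hρk hW' hx] at h1
  rw [fBlk_sub, fBlk_sub, fBlk_Theta_mul_last B _ (by omega), fBlk_mul, fBlk_mul, h3,
    fBlk_midBlk x (by omega), hΦ _ (by omega), ← h1, S]
  simp only [Matrix.mul_add, Matrix.add_mul, Matrix.mul_assoc, zero_add]
  abel

variable {Φ : Matrix (Fin ρ × Fin (s ρ)) (Fin r) ℂ} {Φc : Matrix (Fin ρ × Fin (s ρ)) (Fin r') ℂ}
  {Ωc : Matrix (Fin r') (Fin r') ℂ} {P₁ : Matrix (Fin r) (Fin ρ × Fin (s ρ)) ℂ}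
  {P₂ : Matrix (Fin r') (Fin ρ × Fin (s ρ)) ℂ}

/-- The linearized equation is injective on the normalized subspace. -/
theorem LinEq.eq_zero (h : LinEq B ρ (lead B ρ (fBlk Φ 0) Ω) Ω x X fun _ _ => 0) (hρ : 2 ≤ ρ)
    (hρk : ρ ≤ k) (hW : IsUnit (W B ρ)) (hW' : IsUnit (W B (ρ + 1)))
    (hΦ : Theta B ρ * Φ = Φ * Ω) (hΦc : Theta B ρ * Φc = Φc * Ωc)
    (hd : Disjoint (spectrum ℂ Ω) (spectrum ℂ Ωc)) (hP : Φ * P₁ + Φc * P₂ = 1)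
    (h₁₁ : P₁ * Φ = 1) (h₁₂ : P₁ * Φc = 0) (h₂₁ : P₂ * Φ = 0) (h₂₂ : P₂ * Φc = 1)
    (hx : P₁ * midBlk ρ x = 0) : x = 0 ∧ X = 0 := by
  have hΩ : IsUnit Ω := isUnit_of_intertwine B (by omega) (isUnit_S hρk hW hW') hΦ h₁₁
  have hsmall : ∀ i < ρ, ∀ l, rowBlk x i l = 0 := fun i hi l =>
    h.rowBlk_small_eq_zero hΩ hi (fun _ _ _ => rfl) l
  have hsmall' : ∀ i < ρ - 1, ∀ l, rowBlk x i l = 0 := fun i hi l => hsmall i (by omega) l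
  have hbig : bigRhs k ρ (fun i _ => (0 : Matrix (Fin (s i)) (Fin r) ℂ)) = 0 := rfl
  have hT := h.rowsFrom_eq hρ hρk hW' hsmall'
  have hΦl : ∀ l < ρ, fBlk Φ l = fBlk Φ 0 * Ω ^ l := fun l hl => fBlk_of_intertwine B hΦ hl
  have hR : Theta B ρ * midBlk ρ x - midBlk ρ x * Ω - Φ * X = 0 := by
    refine fBlk_ext fun l hl => ?_
    have h0 : fBlk (0 : Matrix (Fin ρ × Fin (s ρ)) (Fin r) ℂ) l = 0 := by
      ext y c
      simp [fBlk]
    rw [h0]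
    by_cases hl' : l + 1 < ρ
    · exact h.fBlk_mid_of_lt hρk hΦl hl'
    · obtain rfl : l = ρ - 1 := by omega
      rw [h.fBlk_mid_last hρ hρk hW' hsmall' hΦl, hbig, hsmall (ρ - 1) (by omega)]
      simp
  -- Left invariance of `P₁` and the normalization `P₁ φ = 0` leave only `X`.
  have hX : X = 0 := by
    have := congrArg (fun T => P₁ * T) hR
    simp only [Matrix.mul_sub, Matrix.mul_zero,
      dual_mul_Theta_mul B hΦ hΦc hP h₁₁ h₁₂, ← Matrix.mul_assoc P₁, hx, h₁₁, Matrix.zero_mul,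
      Matrix.one_mul, sub_zero, zero_sub, neg_eq_zero] at this
    exact this
  -- Since `P₂ Φ = 0`, the complementary component intertwines `Ωc` and `Ω`.
  have hφ : P₂ * midBlk ρ x = 0 := by
    refine eq_zero_of_intertwine hd.symm ?_
    have := congrArg (fun T => P₂ * T) hR
    simp only [Matrix.mul_sub, Matrix.mul_zero,
      dual_mul_Theta_mul B hΦc hΦ (by rwa [add_comm]) h₂₂ h₂₁, ← Matrix.mul_assoc P₂, h₂₁,
      Matrix.zero_mul, sub_zero, sub_eq_zero] at this
    exact this
  have hmid : midBlk ρ x = 0 := by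
    rw [← Matrix.one_mul (midBlk ρ x), ← hP, Matrix.add_mul, Matrix.mul_assoc, Matrix.mul_assoc,
      hx, hφ, Matrix.mul_zero, Matrix.mul_zero, add_zero]
  have hmidl : ∀ l, rowBlk x ρ l = 0 := by
    intro l
    by_cases hv : (1 ≤ ρ ∧ ρ ≤ k) ∧ (1 ≤ l ∧ l ≤ ρ)
    · have := fBlk_midBlk (ρ := ρ) x (l := l - 1) (by omega)
      rw [Nat.sub_add_cancel hv.2.1, hmid] at this
      rw [← this]
      ext y c
      simp [fBlk]
    · exact rowBlk_void _ hv
  rw [hbig, hsmall (ρ - 1) (by omega), hmidl, Matrix.mul_zero, Matrix.mul_zero, Matrix.mul_zero,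
    add_zero, add_zero] at hT
  refine ⟨rowBlk_ext fun i l hi hik hl hli => ?_, hX⟩
  rw [rowBlk_zero]
  rcases lt_trichotomy i ρ with hlt | rfl | hgt
  · exact hsmall i hlt l
  · exact hmidl l
  -- The level-one parts now vanish, and each equation determines the next level from the previous
  -- ones.
  · induction l, hl using Nat.le_induction with
    | base =>
      rw [← tBlk_rowsFrom (a := ρ + 1) x 1 hgt, hT]
      ext y c
      simp [tBlk]
    | succ l hl ih =>
      have h1 := h i l hi hik hl (by omega)
      rw [rowBlk_mul_lvl_mul_of_vanish hρ hρk B x 1 fun j _ hj => hsmall' j hj 1, hT, hmidl,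
        hsmall (ρ - 1) (by omega), ih (by omega), hX] at h1
      simpa using h1

end linear

/-! ### First order coefficients -/

section firstOrder

variable {r r' : ℕ} {B : Matrix (JIdx k s) (JIdx k s) ℂ} {ρ : ℕ}
  {Q : Matrix (Fin (s ρ)) (Fin r) ℂ} {Ω : Matrix (Fin r) (Fin r) ℂ}
  {x : Matrix (JIdx k s) (Fin r) ℂ} {X : Matrix (Fin r) (Fin r) ℂ}

/-- The right-hand side of the equation for the first order term. -/
def firstRhs (B : Matrix (JIdx k s) (JIdx k s) ℂ) (ρ : ℕ) (Q : Matrix (Fin (s ρ)) (Fin r) ℂ)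
    (Ω : Matrix (Fin r) (Fin r) ℂ) (i l : ℕ) : Matrix (Fin (s i)) (Fin r) ℂ :=
  (if ρ < l then rowBlk (lead B ρ Q Ω) i l * Ω else 0)
    - (if l + 1 = ρ then Bhat B ρ i l * Q else 0)
    - (if ρ ≤ l then (blk B i ρ l 2 + blkRow B i (ρ + 1) l 2 * G B ρ ρ) * Q * Ω else 0)

theorem tBlk_Ctilde {i : ℕ} (hi : ρ < i) (hik : i ≤ k) :
    tBlk (Ctilde B ρ) i = (if i = ρ + 1 then tBlk (G B ρ ρ) i * S B ρ else 0)
      - (Bhat B ρ i (i - 1) + blk B i ρ i 2 + blkRow B i (ρ + 1) i 2 * G B ρ ρ) := by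
  ext y c
  have h : ρ + 1 ≤ i ∧ i ≤ k := ⟨hi, hik⟩
  have hi' : i ∈ Set.Icc (ρ + 1) k := h
  have hC : tBlk (Ctilde B ρ) i y c = Ctilde B ρ ⟨⟨i, hi'⟩, y⟩ c :=
    tBlk_apply (Ctilde B ρ) ⟨⟨i, hi'⟩, y⟩ c
  rw [← tBlk_mul, hC]
  by_cases hi1 : i = ρ + 1
  · have := tBlk_apply (G B ρ ρ * S B ρ) ⟨⟨i, hi'⟩, y⟩ c
    simp only at this
    rw [if_pos hi1, Matrix.sub_apply, this]
    simp [Ctilde, hi1]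
  · rw [if_neg hi1, Matrix.sub_apply]
    simp [Ctilde, hi1]

/-- The exceptional term of `Ctilde` comes from block `ρ + 1`: its last level is obtained from level
`ρ`, where the geometric chain and the perturbation overlap. The chain contributes `G Q Ω^ρ = G S
Q`. -/
theorem bigRhs_firstRhs (hρ : 2 ≤ ρ) (hQ : S B ρ * Q = Q * Ω ^ ρ) :
    bigRhs k ρ (firstRhs B ρ Q Ω) = Ctilde B ρ * Q * Ω := by
  ext ⟨⟨i, hi⟩, y⟩ c
  have hi1 : ρ + 1 ≤ i := hi.1
  rw [← tBlk_apply (Ctilde B ρ * Q * Ω)]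
  suffices h : firstRhs B ρ Q Ω i i = tBlk (Ctilde B ρ * Q * Ω) i from congrFun (congrFun h y) c
  have hl : rowBlk (lead B ρ Q Ω) i i
      = ((if i = ρ + 1 then tBlk (G B ρ ρ) i * S B ρ else 0) - Bhat B ρ i (i - 1)) * Q := by
    obtain ⟨l, rfl⟩ : ∃ l, i = l + 1 := ⟨i - 1, by omega⟩
    rw [rowBlk_lead (by omega) hi.2 (by omega) le_rfl, leadBlk_succ (by omega),
      if_pos (by omega : ρ ≤ l), Nat.add_sub_cancel, Matrix.sub_mul]
    by_cases h' : l = ρ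
    · obtain ⟨m, rfl⟩ : ∃ m, l = m + 1 := ⟨l - 1, by omega⟩
      have hpow : Ω ^ (m + 1) = Ω ^ ρ := by rw [h']
      rw [if_pos h'.le, if_pos (by omega), leadBlk_of_le _ h'.le, tBlk_mul, tBlk_IG_of_lt hi1,
        Matrix.mul_assoc, Matrix.mul_assoc, ← pow_succ, hpow, Matrix.mul_assoc, hQ]
    · rw [if_neg (by omega), if_neg (by omega), Matrix.zero_mul]
  rw [firstRhs, if_pos (by omega), if_neg (by omega), if_pos (by omega), hl, tBlk_mul, tBlk_mul,
    tBlk_Ctilde hi1 hi.2]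
  simp only [Matrix.add_mul, Matrix.sub_mul]
  abel

variable {Φ : Matrix (Fin ρ × Fin (s ρ)) (Fin r) ℂ} {Φc : Matrix (Fin ρ × Fin (s ρ)) (Fin r') ℂ}
  {Ωc : Matrix (Fin r') (Fin r') ℂ} {P₁ : Matrix (Fin r) (Fin ρ × Fin (s ρ)) ℂ}
  {P₂ : Matrix (Fin r') (Fin ρ × Fin (s ρ)) ℂ}

/-- The first order terms of the scaled invariant subspace. -/
theorem LinEq.first_order
    (h : LinEq B ρ (lead B ρ (fBlk Φ 0) Ω) Ω x X (firstRhs B ρ (fBlk Φ 0) Ω)) (hρ : 2 ≤ ρ)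
    (hρk : ρ ≤ k) (hW : IsUnit (W B ρ)) (hW' : IsUnit (W B (ρ + 1)))
    (hΦ : Theta B ρ * Φ = Φ * Ω) (hΦc : Theta B ρ * Φc = Φc * Ωc)
    (hd : Disjoint (spectrum ℂ Ω) (spectrum ℂ Ωc)) (hP : Φ * P₁ + Φc * P₂ = 1)
    (h₁₁ : P₁ * Φ = 1) (h₁₂ : P₁ * Φc = 0) (h₂₁ : P₂ * Φ = 0) (h₂₂ : P₂ * Φc = 1)
    (hx : P₁ * midBlk ρ x = 0)
    {Qt₁ : Matrix (Fin r) (Fin (s ρ)) ℂ} {Qt₂ : Matrix (Fin r') (Fin (s ρ)) ℂ}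
    (hQt₁ : Qt₁ * S B ρ = Ω ^ ρ * Qt₁) (hQt₂ : Qt₂ * S B ρ = Ωc ^ ρ * Qt₂)
    (hM : IsUnit (Msum ρ Ω Qt₁ (fBlk Φ 0))) (hMc : IsUnit (Msum ρ Ωc Qt₂ (fBlk Φc 0)))
    {Y : Matrix (Fin r') (Fin r) ℂ}
    (hY : Ωc * Y - Y * Ω
      + (Delta B ρ Ω Ωc (fBlk Φ 0) (fBlk Φc 0) Qt₁ Qt₂).toBlocks₂₁ = 0) :
    X = (Delta B ρ Ω Ωc (fBlk Φ 0) (fBlk Φc 0) Qt₁ Qt₂).toBlocks₁₁ ∧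
    (∀ i < ρ - 1, ∀ l, rowBlk x i l = 0) ∧
    rowBlk x (ρ - 1) 1 = Bhat B ρ (ρ - 1) (ρ - 1) * (S B ρ)⁻¹ * fBlk Φ 0 * Ω ∧
    rowBlk x ρ 1 = fBlk Φc 0 * Y ∧
    rowsFrom x (ρ + 1) 1 = Cmat B ρ * fBlk Φ 0 * Ω + G B ρ ρ * fBlk Φc 0 * Y := by
  set Q := fBlk Φ 0 with hQdef
  have hS := isUnit_S hρk hW hW'
  have hΩ : IsUnit Ω := isUnit_of_intertwine B (by omega) hS hΦ h₁₁
  have hQ : S B ρ * Q = Q * Ω ^ ρ := S_mul_of_intertwine B (by omega) hΦ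
  have hsmall : ∀ i < ρ - 1, ∀ l, rowBlk x i l = 0 := fun i hi l =>
    h.rowBlk_small_eq_zero hΩ (by omega) (fun l h1 h2 => by
      rw [firstRhs, if_neg (by omega), if_neg (by omega), if_neg (by omega), sub_zero, sub_zero]) l
  have hp : rowBlk x (ρ - 1) 1 = Bhat B ρ (ρ - 1) (ρ - 1) * (S B ρ)⁻¹ * Q * Ω := by
    have h1 := h.rowBlk_small_last (i := ρ - 1) (by omega) (by omega) (by omega)
      (fun l h1 h2 => by
        rw [firstRhs, if_neg (by omega), if_neg (by omega), if_neg (by omega), sub_zero,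
          sub_zero])
    rw [firstRhs, if_neg (by omega), if_pos (by omega), if_neg (by omega), sub_zero, zero_sub,
      neg_neg] at h1
    -- The last equation of block `ρ - 1` is `x Ω^{ρ-1} = B̂ Q`. Writing `Q = S⁻¹ Q Ω^ρ` exposes the
    -- factor `Ω^{ρ-1}` on the right, to be cancelled.
    have h2 : Q = (S B ρ)⁻¹ * Q * Ω * Ω ^ (ρ - 1) := by
      rw [Matrix.mul_assoc, ← pow_succ', Nat.sub_add_cancel (by omega), Matrix.mul_assoc, ← hQ,
        ← Matrix.mul_assoc, Matrix.nonsing_inv_mul _ ((Matrix.isUnit_iff_isUnit_det _).1 hS),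
        Matrix.one_mul]
    have hu := (Matrix.isUnit_iff_isUnit_det _).1 (hΩ.pow (ρ - 1))
    calc rowBlk x (ρ - 1) 1 = rowBlk x (ρ - 1) 1 * Ω ^ (ρ - 1) * (Ω ^ (ρ - 1))⁻¹ := by
          rw [Matrix.mul_assoc, Matrix.mul_nonsing_inv _ hu, Matrix.mul_one]
      _ = Bhat B ρ (ρ - 1) (ρ - 1) * ((S B ρ)⁻¹ * Q * Ω * Ω ^ (ρ - 1)) * (Ω ^ (ρ - 1))⁻¹ := by
          rw [h1, ← h2]
      _ = Bhat B ρ (ρ - 1) (ρ - 1) * ((S B ρ)⁻¹ * Q * Ω) * (Ω ^ (ρ - 1) * (Ω ^ (ρ - 1))⁻¹) := by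
          simp only [Matrix.mul_assoc]
      _ = _ := by
          rw [Matrix.mul_nonsing_inv _ hu, Matrix.mul_one]
          simp only [Matrix.mul_assoc]
  have hbig := bigRhs_firstRhs (B := B) hρ hQ
  have hC : (W B (ρ + 1))⁻¹ * bigRhs k ρ (firstRhs B ρ Q Ω)
      + G B ρ (ρ - 1) * rowBlk x (ρ - 1) 1 = Cmat B ρ * Q * Ω := by
    rw [hbig, hp, Cmat]
    simp only [Matrix.add_mul, Matrix.mul_assoc]
  have hT := h.rowsFrom_eq hρ hρk hW' hsmall
  rw [hC] at hT
  have hΦl : ∀ l < ρ, fBlk Φ l = Q * Ω ^ l := fun l hl => fBlk_of_intertwine B hΦ hl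
  set R := Theta B ρ * midBlk ρ x - midBlk ρ x * Ω - Φ * X with hR
  -- Blocks of `R` are counted from `0`, so index `ρ - 2` is level `ρ - 1`. The perturbation first
  -- reaches that level at order one, and all earlier ones stay zero.
  have hR0 : ∀ l, l + 2 < ρ → fBlk R l = 0 := fun l hl => by
    rw [h.fBlk_mid_of_lt hρk hΦl (by omega), firstRhs, if_neg (by omega), if_neg (by omega),
      if_neg (by omega), sub_zero, sub_zero]
  have hR1 : fBlk R (ρ - 2) = -(Bhat B ρ ρ (ρ - 1) * Q) := by
    have e1 : ρ - 2 + 1 = ρ - 1 := by omega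
    rw [h.fBlk_mid_of_lt hρk hΦl (by omega), e1, firstRhs, if_neg (by omega), if_pos (by omega),
      if_neg (by omega), sub_zero, zero_sub]
  have hR2 : fBlk R (ρ - 1) = -(Bhat2 B ρ * Q * Ω) := by
    rw [h.fBlk_mid_last hρ hρk hW' hsmall hΦl, hC, hp, firstRhs, if_neg (by omega),
      if_neg (by omega), if_pos le_rfl, Bhat2]
    simp only [Matrix.add_mul, Matrix.mul_assoc]
    abel
  have hP₁R : P₁ * R = -X := by
    rw [hR, Matrix.mul_sub, Matrix.mul_sub, dual_mul_Theta_mul B hΦ hΦc hP h₁₁ h₁₂,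
      ← Matrix.mul_assoc P₁, ← Matrix.mul_assoc P₁, hx, h₁₁, Matrix.mul_zero, Matrix.zero_mul,
      Matrix.one_mul, sub_zero, zero_sub]
  have hP' : Φc * P₂ + Φ * P₁ = 1 := by rwa [add_comm]
  have hP₂R : P₂ * R = Ωc * (P₂ * midBlk ρ x) - P₂ * midBlk ρ x * Ω := by
    rw [hR, Matrix.mul_sub, Matrix.mul_sub, dual_mul_Theta_mul B hΦc hΦ hP' h₂₂ h₂₁,
      ← Matrix.mul_assoc P₂, ← Matrix.mul_assoc P₂, h₂₁, Matrix.zero_mul, sub_zero]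
  have hX : X = (Delta B ρ Ω Ωc Q (fBlk Φc 0) Qt₁ Qt₂).toBlocks₁₁ := by
    rw [dual_mul_eq B hρ hΦ hΦc hd hP hQt₁ hM R hR0, hR1, hR2, ← hQdef] at hP₁R
    rw [← neg_neg X, ← hP₁R]
    simp only [Delta, fromBlocks_multiply, toBlocks_fromBlocks₁₁, Matrix.zero_mul,
      Matrix.mul_zero, add_zero, zero_add, Matrix.mul_neg, Matrix.mul_add, neg_add, neg_neg,
      Matrix.mul_assoc]
  have hΔ₂ : P₂ * R = -(Delta B ρ Ω Ωc Q (fBlk Φc 0) Qt₁ Qt₂).toBlocks₂₁ := by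
    rw [dual_mul_eq B hρ hΦc hΦ hd.symm hP' hQt₂ hMc R hR0, hR1, hR2]
    simp only [Delta, fromBlocks_multiply, toBlocks_fromBlocks₂₁, Matrix.zero_mul,
      Matrix.mul_zero, add_zero, zero_add, Matrix.mul_neg, Matrix.mul_add, neg_add,
      Matrix.mul_assoc]
  -- Both `P₂ φ` and `Y` solve the same inhomogeneous Sylvester equation, and disjoint spectra make
  -- the solution unique.
  have hφ : P₂ * midBlk ρ x = Y := by
    rw [← sub_eq_zero]
    refine eq_zero_of_intertwine hd.symm ?_
    rw [← sub_eq_zero]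
    have h1 : Ωc * Y - Y * Ω = P₂ * R := by
      rw [hΔ₂]
      exact eq_neg_of_add_eq_zero_left hY
    rw [hP₂R] at h1
    rw [Matrix.mul_sub, Matrix.sub_mul]
    calc _ = (Ωc * (P₂ * midBlk ρ x) - P₂ * midBlk ρ x * Ω) - (Ωc * Y - Y * Ω) := by abel
      _ = 0 := by rw [h1, sub_self]
  have hmid : midBlk ρ x = Φc * Y := by
    rw [← Matrix.one_mul (midBlk ρ x), ← hP, Matrix.add_mul, Matrix.mul_assoc, Matrix.mul_assoc,
      hx, hφ, Matrix.mul_zero, zero_add]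
  have hq : rowBlk x ρ 1 = fBlk Φc 0 * Y := by
    rw [← fBlk_mul, ← hmid, fBlk_midBlk x (by omega)]
  refine ⟨hX, hsmall, hp, hq, ?_⟩
  rw [hT, hq, Matrix.mul_assoc (G B ρ ρ)]

end firstOrder

/-! ### Orders of magnitude in fractional powers of `t` -/

section asymptotics

variable {m n p : Type*} {F G : ℝ → Matrix m n ℂ} {a b : ℝ}

theorem IsOPow.add (hF : IsOPow F a) (hG : IsOPow G a) : IsOPow (fun t => F t + G t) a :=
  fun i j => (hF i j).add (hG i j)

theorem IsOPow.neg (hF : IsOPow F a) : IsOPow (fun t => -F t) a := fun i j => (hF i j).neg_left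

theorem IsOPow.mono (hF : IsOPow F a) (hab : b ≤ a) : IsOPow F b := by
  intro i j
  refine (hF i j).trans (IsBigO.of_bound 1 ?_)
  filter_upwards [Ioo_mem_nhdsGT (zero_lt_one' ℝ)] with t ht
  rw [one_mul, Real.norm_of_nonneg (Real.rpow_nonneg ht.1.le _),
    Real.norm_of_nonneg (Real.rpow_nonneg ht.1.le _)]
  exact Real.rpow_le_rpow_of_exponent_ge ht.1 ht.2.le hab

theorem IsOPow.mul [Fintype n] {G : ℝ → Matrix n p ℂ} (hF : IsOPow F a) (hG : IsOPow G b) :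
    IsOPow (fun t => F t * G t) (a + b) := by
  intro i j
  simp only [Matrix.mul_apply]
  refine IsBigO.fun_sum fun l _ => ((hF i l).mul (hG l j)).trans_eventuallyEq ?_
  filter_upwards [self_mem_nhdsWithin] with t ht
  exact (Real.rpow_add ht a b).symm

theorem IsOPow.congr (hF : IsOPow F a) (h : ∀ᶠ t in 𝓝[>] (0 : ℝ), G t = F t) : IsOPow G a :=
  fun i j => (hF i j).congr' (h.mono fun t ht => by simp only [ht]) EventuallyEq.rfl

theorem isOPow_tpow_smul (M : Matrix m n ℂ) (a : ℝ) : IsOPow (fun t => tpow t a • M) a := by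
  intro i j
  refine IsBigO.of_bound ‖M i j‖ (Eventually.of_forall fun t => ?_)
  simp [tpow, mul_comm]

theorem isOPow_const (M : Matrix m n ℂ) : IsOPow (fun _ => M) 0 := by
  simpa [tpow] using isOPow_tpow_smul M 0

theorem tendsto_tpow {c : ℝ} (hc : 0 < c) : Tendsto (fun t => tpow t c) (𝓝[>] 0) (𝓝 0) := by
  have h : Tendsto (fun t : ℝ => t ^ c) (𝓝 0) (𝓝 0) := by
    have := (Real.continuousAt_rpow_const 0 c (Or.inr hc.le)).tendsto
    rwa [Real.zero_rpow hc.ne'] at this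
  have h2 := (Complex.continuous_ofReal.tendsto 0).comp
    (h.mono_left (nhdsWithin_le_nhds (s := Set.Ioi 0)))
  rw [Complex.ofReal_zero] at h2
  exact h2

theorem tpow_pow {t : ℝ} (ht : 0 < t) (c : ℝ) (e : ℕ) : tpow t c ^ e = tpow t (c * e) := by
  rw [tpow, tpow, ← Complex.ofReal_pow, Real.rpow_mul ht.le, Real.rpow_natCast]

/-- The first order Taylor expansion of an analytic matrix function at `c = t^{1/ρ}`. -/
theorem isOPow_taylor {F : ℂ → Matrix m n ℂ} {F' : Matrix m n ℂ} (hF : AnalyticZero F)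
    (hF' : HasDerivZero F F') {ρ : ℕ} (hρ : 0 < ρ) :
    IsOPow (fun t => F (tpow t (1 / ρ)) - (F 0 + tpow t (1 / ρ) • F')) (2 / ρ) := by
  intro i j
  have hc : (0 : ℝ) < 1 / ρ := by positivity
  refine ((isBigO_sq_of_analyticAt (hF i j) (hF' i j)).comp_tendsto (tendsto_tpow hc)).trans ?_
  refine IsBigO.of_bound 1 ?_
  filter_upwards [self_mem_nhdsWithin] with t ht
  have h2 : (1 / ρ : ℝ) * (2 : ℕ) = 2 / ρ := by push_cast; ring
  simp only [Function.comp_apply]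
  rw [tpow_pow ht, h2, tpow, Complex.norm_real, one_mul]

end asymptotics

theorem rank_eq_of_leftInverse {m : Type*} [Fintype m] [DecidableEq m] {r : ℕ}
    {H : Matrix m (Fin r) ℂ} {L : Matrix (Fin r) m ℂ} (h : L * H = 1) : H.rank = r := by
  refine le_antisymm (by simpa using H.rank_le_card_width) ?_
  have := Matrix.rank_mul_le_right L H
  rwa [h, Matrix.rank_one, Fintype.card_fin] at this

/-! ### Separating the Jordan coordinates from the complement -/

section rows

variable {α β κ κ' : Type*}

theorem toRows₁_mul [Fintype κ] (x : Matrix (α ⊕ β) κ ℂ) (y : Matrix κ κ' ℂ) :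
    (x * y).toRows₁ = x.toRows₁ * y := rfl

theorem toRows₁_add (x y : Matrix (α ⊕ β) κ ℂ) : (x + y).toRows₁ = x.toRows₁ + y.toRows₁ := rfl

theorem toRows₂_add (x y : Matrix (α ⊕ β) κ ℂ) : (x + y).toRows₂ = x.toRows₂ + y.toRows₂ := rfl

theorem toRows₁_sub (x y : Matrix (α ⊕ β) κ ℂ) : (x - y).toRows₁ = x.toRows₁ - y.toRows₁ := rfl

theorem toRows₂_sub (x y : Matrix (α ⊕ β) κ ℂ) : (x - y).toRows₂ = x.toRows₂ - y.toRows₂ := rfl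

theorem lev_const_of_ne [DecidableEq α] {a b : ℕ} (h : a ≠ b) :
    lev (fun _ : α => a) b = 0 := by
  simp [lev, h]

variable [Fintype α] [Fintype β]

theorem toRows₁_fromBlocks_mul (M₁ : Matrix α α ℂ) (M₂ : Matrix α β ℂ) (M₃ : Matrix β α ℂ)
    (M₄ : Matrix β β ℂ) (x : Matrix (α ⊕ β) κ ℂ) :
    (fromBlocks M₁ M₂ M₃ M₄ * x).toRows₁ = M₁ * x.toRows₁ + M₂ * x.toRows₂ := by
  conv_lhs => rw [← fromRows_toRows x, fromBlocks_mul_fromRows, toRows₁_fromRows]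

theorem toRows₂_fromBlocks_mul (M₁ : Matrix α α ℂ) (M₂ : Matrix α β ℂ) (M₃ : Matrix β α ℂ)
    (M₄ : Matrix β β ℂ) (x : Matrix (α ⊕ β) κ ℂ) :
    (fromBlocks M₁ M₂ M₃ M₄ * x).toRows₂ = M₃ * x.toRows₁ + M₄ * x.toRows₂ := by
  conv_lhs => rw [← fromRows_toRows x, fromBlocks_mul_fromRows, toRows₂_fromRows]

variable [DecidableEq α] [DecidableEq β]

theorem toRows₁_lev_mul (f : α → ℕ) (g : β → ℕ) (a : ℕ) (x : Matrix (α ⊕ β) κ ℂ) :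
    (lev (Sum.elim f g) a * x).toRows₁ = lev f a * x.toRows₁ := by
  ext i j
  simp only [lev, diagonal_mul, toRows₁_apply, Sum.elim_inl]
  rfl

theorem toRows₂_lev_mul (f : α → ℕ) (g : β → ℕ) (a : ℕ) (x : Matrix (α ⊕ β) κ ℂ) :
    (lev (Sum.elim f g) a * x).toRows₂ = lev g a * x.toRows₂ := by
  ext i j
  simp only [lev, diagonal_mul, toRows₂_apply, Sum.elim_inr]
  rfl

end rows

/-! ### The scaling exponents and the scaled family -/

/-- The exponents of the scaling of the columns. -/
def dExp (k : ℕ) (s : ℕ → ℕ) (q ρ : ℕ) : JIdx k s ⊕ Fin q → ℕ :=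
  Sum.elim (fun p => min ((p.2.1 : ℕ) - 1) ρ) fun _ => 0

/-- The exponents of the scaled perturbation. -/
def gExp (k : ℕ) (s : ℕ → ℕ) (q ρ : ℕ) : JIdx k s ⊕ Fin q → ℕ :=
  Sum.elim (fun p => ρ - (p.2.1 : ℕ)) fun _ => ρ

/-- The exponents of the scaled spectral parameter. -/
def hExp (k : ℕ) (s : ℕ → ℕ) (q ρ : ℕ) : JIdx k s ⊕ Fin q → ℕ :=
  Sum.elim (fun p => if (p.2.1 : ℕ) ≤ ρ then 0 else 1) fun _ => 1

/-- Since `ρ ≥ 2`, the cap in the exponent affects no exponent below `2`, and levels start at `1`.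
-/
theorem lev_d_zero {ρ : ℕ} (hρ : 2 ≤ ρ) :
    lev (fun p : JIdx k s => min ((p.2.1 : ℕ) - 1) ρ) 0 = lvl k s 1 := by
  rw [lev, lvl, lev]
  congr 1
  ext p
  have h := p.2.1.2.1
  refine if_congr ?_ rfl rfl
  omega

theorem lev_d_one {ρ : ℕ} (hρ : 2 ≤ ρ) :
    lev (fun p : JIdx k s => min ((p.2.1 : ℕ) - 1) ρ) 1 = lvl k s 2 := by
  rw [lev, lvl, lev]
  congr 1
  ext p
  have h := p.2.1.2.1
  refine if_congr ?_ rfl rfl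
  omega

section

variable {q r r' ρ : ℕ} {B : Matrix (JIdx k s) (JIdx k s) ℂ}

theorem rowBlk_lev_g_zero_mul (x : Matrix (JIdx k s) (Fin r) ℂ) (i l : ℕ) :
    rowBlk (lev (fun p : JIdx k s => ρ - (p.2.1 : ℕ)) 0 * x) i l
      = if ρ ≤ l then rowBlk x i l else 0 := by
  rw [rowBlk_lev_mul _ (fun l => ρ - l) (fun _ => rfl)]
  exact if_congr Nat.sub_eq_zero_iff_le rfl rfl

theorem rowBlk_lev_g_one_mul (x : Matrix (JIdx k s) (Fin r) ℂ) (i l : ℕ) :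
    rowBlk (lev (fun p : JIdx k s => ρ - (p.2.1 : ℕ)) 1 * x) i l
      = if l + 1 = ρ then rowBlk x i l else 0 := by
  rw [rowBlk_lev_mul _ (fun l => ρ - l) (fun _ => rfl)]
  exact if_congr (by omega) rfl rfl

theorem rowBlk_lev_h_zero_mul (x : Matrix (JIdx k s) (Fin r) ℂ) (i l : ℕ) :
    rowBlk (lev (fun p : JIdx k s => if (p.2.1 : ℕ) ≤ ρ then 0 else 1) 0 * x) i l
      = if l ≤ ρ then rowBlk x i l else 0 := by
  rw [rowBlk_lev_mul _ (fun l => if l ≤ ρ then 0 else 1) (fun _ => rfl)]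
  exact if_congr (by split_ifs <;> simp_all) rfl rfl

theorem rowBlk_lev_h_one_mul (x : Matrix (JIdx k s) (Fin r) ℂ) (i l : ℕ) :
    rowBlk (lev (fun p : JIdx k s => if (p.2.1 : ℕ) ≤ ρ then 0 else 1) 1 * x) i l
      = if ρ < l then rowBlk x i l else 0 := by
  rw [rowBlk_lev_mul _ (fun l => if l ≤ ρ then 0 else 1) (fun _ => rfl)]
  exact if_congr (by split_ifs <;> simp_all) rfl rfl

/-- The leading term solves the limit equation. -/
theorem lead_residual (D₁₂ : Matrix (JIdx k s) (Fin q) ℂ)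
    (D₂₁ : Matrix (Fin q) (JIdx k s) ℂ) (D₂₂ M : Matrix (Fin q) (Fin q) ℂ)
    (hρ : 2 ≤ ρ) (hρk : ρ ≤ k) (hW' : IsUnit (W B (ρ + 1)))
    {Q : Matrix (Fin (s ρ)) (Fin r) ℂ} {Ω : Matrix (Fin r) (Fin r) ℂ}
    (hQ : S B ρ * Q = Q * Ω ^ ρ) :
    fromBlocks (jordanN k s) 0 0 M * fromRows (lead B ρ Q Ω) (0 : Matrix (Fin q) (Fin r) ℂ)
      + lev (gExp k s q ρ) 0 * (fromBlocks B D₁₂ D₂₁ D₂₂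
          * (lev (dExp k s q ρ) 0 * fromRows (lead B ρ Q Ω) (0 : Matrix (Fin q) (Fin r) ℂ)))
      - lev (hExp k s q ρ) 0 * (fromRows (lead B ρ Q Ω) (0 : Matrix (Fin q) (Fin r) ℂ) * Ω) = 0 := by
  have hlev0 : lev (fun _ : Fin q => ρ) 0 = 0 := lev_const_of_ne (by omega)
  have hlev2 : lev (fun _ : Fin q => 1) 0 = 0 := lev_const_of_ne (by omega)
  rw [← fromRows_toRows (_ - _), ← fromRows_zero, fromRows_ext_iff, dExp, gExp, hExp,
    fromRows_mul]
  simp only [toRows₁_sub, toRows₁_add, toRows₁_fromBlocks_mul, toRows₁_lev_mul,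
    toRows₂_sub, toRows₂_add, toRows₂_fromBlocks_mul, toRows₂_lev_mul,
    toRows₁_fromRows, toRows₂_fromRows, lev_d_zero hρ,
    hlev0, hlev2, Matrix.mul_zero, Matrix.zero_mul, add_zero, sub_zero, and_true]
  refine rowBlk_ext fun i l hi hik hl hli => ?_
  rw [rowBlk_sub, rowBlk_add, rowBlk_jordanN_mul _ i hl, rowBlk_lev_g_zero_mul,
    rowBlk_lev_h_zero_mul, rowBlk_zero, rowBlk_mul _ Ω]
  exact lead_equation hρ hρk hW' hQ hi hik hl hli

/-- The linearized equation with zero right-hand side, reduced to blocks. -/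
theorem linEq_zero_of_residual {D₁₂ : Matrix (JIdx k s) (Fin q) ℂ}
    {D₂₁ : Matrix (Fin q) (JIdx k s) ℂ} {D₂₂ M : Matrix (Fin q) (Fin q) ℂ}
    (hM : ∀ y : Matrix (Fin q) (Fin r) ℂ, M * y = 0 → y = 0) (hρ : 2 ≤ ρ)
    {a : Matrix (JIdx k s) (Fin r) ℂ} {Ω X : Matrix (Fin r) (Fin r) ℂ}
    {y : Matrix (JIdx k s ⊕ Fin q) (Fin r) ℂ}
    (hy : fromBlocks (jordanN k s) 0 0 M * y
      + lev (gExp k s q ρ) 0 * (fromBlocks B D₁₂ D₂₁ D₂₂ * (lev (dExp k s q ρ) 0 * y))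
      - lev (hExp k s q ρ) 0 * (y * Ω + fromRows a (0 : Matrix (Fin q) (Fin r) ℂ) * X) = 0) :
    y.toRows₂ = 0 ∧ LinEq B ρ a Ω y.toRows₁ X fun _ _ => 0 := by
  have hlev0 : lev (fun _ : Fin q => ρ) 0 = 0 := lev_const_of_ne (by omega)
  have hlev2 : lev (fun _ : Fin q => 1) 0 = 0 := lev_const_of_ne (by omega)
  rw [dExp, gExp, hExp, fromRows_mul] at hy
  have h1 := congrArg toRows₁ hy
  have h2 := congrArg toRows₂ hy
  simp only [toRows₂_sub, toRows₂_add, toRows₂_fromBlocks_mul, toRows₂_lev_mul, hlev0, hlev2,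
    Matrix.zero_mul, add_zero, zero_add, sub_zero] at h2
  have hy2 : y.toRows₂ = 0 := hM _ h2
  simp only [toRows₁_sub, toRows₁_add, toRows₁_fromBlocks_mul, toRows₁_lev_mul, toRows₂_lev_mul,
    toRows₁_fromRows, lev_d_zero hρ, hy2, Matrix.mul_zero, Matrix.zero_mul,
    add_zero] at h1
  rw [toRows₁_mul] at h1
  refine ⟨hy2, fun i l hi hik hl hli => ?_⟩
  have h3 := congrArg (fun T => rowBlk T i l) h1
  simp only [rowBlk_sub, rowBlk_jordanN_mul _ i hl, rowBlk_lev_g_zero_mul,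
    rowBlk_lev_h_zero_mul, rowBlk_add] at h3
  rw [rowBlk_mul _ Ω, rowBlk_mul _ X] at h3
  exact h3.trans (rowBlk_zero i l)

/-- The first order equation, reduced to blocks. -/
theorem linEq_first_of_residual {D₁₂ : Matrix (JIdx k s) (Fin q) ℂ}
    {D₂₁ : Matrix (Fin q) (JIdx k s) ℂ} {D₂₂ M : Matrix (Fin q) (Fin q) ℂ}
    (hM : ∀ y : Matrix (Fin q) (Fin r) ℂ, M * y = 0 → y = 0) (hρ : 2 ≤ ρ) (hρk : ρ ≤ k)
    {Q : Matrix (Fin (s ρ)) (Fin r) ℂ} {Ω X : Matrix (Fin r) (Fin r) ℂ}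
    {y : Matrix (JIdx k s ⊕ Fin q) (Fin r) ℂ}
    (hy : fromBlocks (jordanN k s) 0 0 M * y
      + (lev (gExp k s q ρ) 1 * (fromBlocks B D₁₂ D₂₁ D₂₂
            * (lev (dExp k s q ρ) 0 * fromRows (lead B ρ Q Ω) (0 : Matrix (Fin q) (Fin r) ℂ)))
          + lev (gExp k s q ρ) 0 * (fromBlocks B D₁₂ D₂₁ D₂₂
            * (lev (dExp k s q ρ) 1 * fromRows (lead B ρ Q Ω) (0 : Matrix (Fin q) (Fin r) ℂ) + lev (dExp k s q ρ) 0 * y)))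
      - (lev (hExp k s q ρ) 1 * (fromRows (lead B ρ Q Ω) (0 : Matrix (Fin q) (Fin r) ℂ) * Ω)
          + lev (hExp k s q ρ) 0 * (y * Ω + fromRows (lead B ρ Q Ω) (0 : Matrix (Fin q) (Fin r) ℂ) * X)) = 0) :
    y.toRows₂ = 0 ∧ LinEq B ρ (lead B ρ Q Ω) Ω y.toRows₁ X (firstRhs B ρ Q Ω) := by
  have hlev0 : lev (fun _ : Fin q => ρ) 0 = 0 := lev_const_of_ne (by omega)
  have hlev1 : lev (fun _ : Fin q => ρ) 1 = 0 := lev_const_of_ne (by omega)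
  have hlev2 : lev (fun _ : Fin q => 1) 0 = 0 := lev_const_of_ne (by omega)
  rw [dExp, gExp, hExp, fromRows_mul, fromRows_mul] at hy
  have h1 := congrArg toRows₁ hy
  have h2 := congrArg toRows₂ hy
  simp only [toRows₂_sub, toRows₂_add, toRows₂_fromBlocks_mul, toRows₂_lev_mul, hlev0, hlev1,
    hlev2, toRows₂_fromRows, Matrix.zero_mul, Matrix.mul_zero, add_zero, zero_add, sub_zero] at h2
  have hy2 : y.toRows₂ = 0 := hM _ h2
  simp only [toRows₁_sub, toRows₁_add, toRows₁_fromBlocks_mul, toRows₁_lev_mul, toRows₂_add,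
    toRows₂_lev_mul, toRows₁_fromRows, toRows₂_fromRows, lev_d_zero hρ,
    lev_d_one hρ, hy2, Matrix.mul_zero, Matrix.zero_mul, add_zero] at h1
  rw [toRows₁_mul] at h1
  refine ⟨hy2, fun i l hi hik hl hli => ?_⟩
  have h3 := congrArg (fun T => rowBlk T i l) h1
  simp only [Matrix.mul_add, rowBlk_sub, rowBlk_add, rowBlk_jordanN_mul _ i hl,
    rowBlk_lev_g_zero_mul, rowBlk_lev_h_zero_mul, rowBlk_lev_g_one_mul,
    rowBlk_lev_h_one_mul] at h3
  have e2 : rowBlk (B * (lvl k s 2 * lead B ρ Q Ω)) i l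
      = (blk B i ρ l 2 + blkRow B i (ρ + 1) l 2 * G B ρ ρ) * Q * Ω :=
    (rowBlk_mul_lvl_lead hρ hρk i l 1 hρ).trans (by rw [pow_one])
  rw [rowBlk_mul_lvl_one_lead hρ hρk, e2, rowBlk_mul _ Ω, rowBlk_mul _ Ω, rowBlk_mul _ X] at h3
  rw [firstRhs, ← sub_eq_zero]
  refine Eq.trans ?_ (h3.trans (rowBlk_zero i l))
  by_cases hlρ : l ≤ ρ
  · simp only [if_pos hlρ]
    abel
  · simp only [if_neg hlρ]
    abel

/-- Existence of the scaled invariant subspace, with its first order terms. -/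
theorem exists_scaled_family (D₁₂ : Matrix (JIdx k s) (Fin q) ℂ)
    (D₂₁ : Matrix (Fin q) (JIdx k s) ℂ) (D₂₂ M : Matrix (Fin q) (Fin q) ℂ) (hMu : IsUnit M)
    (hρ : 2 ≤ ρ) (hρk : ρ ≤ k) (hW : IsUnit (W B ρ)) (hW' : IsUnit (W B (ρ + 1)))
    {Φ : Matrix (Fin ρ × Fin (s ρ)) (Fin r) ℂ} {Φc : Matrix (Fin ρ × Fin (s ρ)) (Fin r') ℂ}
    {Ω : Matrix (Fin r) (Fin r) ℂ} {Ωc : Matrix (Fin r') (Fin r') ℂ}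
    {P₁ : Matrix (Fin r) (Fin ρ × Fin (s ρ)) ℂ} {P₂ : Matrix (Fin r') (Fin ρ × Fin (s ρ)) ℂ}
    (hΦ : Theta B ρ * Φ = Φ * Ω) (hΦc : Theta B ρ * Φc = Φc * Ωc)
    (hd : Disjoint (spectrum ℂ Ω) (spectrum ℂ Ωc)) (hP : Φ * P₁ + Φc * P₂ = 1)
    (h₁₁ : P₁ * Φ = 1) (h₁₂ : P₁ * Φc = 0) (h₂₁ : P₂ * Φ = 0) (h₂₂ : P₂ * Φc = 1)
    {Qt₁ : Matrix (Fin r) (Fin (s ρ)) ℂ} {Qt₂ : Matrix (Fin r') (Fin (s ρ)) ℂ}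
    (hQt₁ : Qt₁ * S B ρ = Ω ^ ρ * Qt₁) (hQt₂ : Qt₂ * S B ρ = Ωc ^ ρ * Qt₂)
    (hM : IsUnit (Msum ρ Ω Qt₁ (fBlk Φ 0))) (hMc : IsUnit (Msum ρ Ωc Qt₂ (fBlk Φc 0)))
    {Y : Matrix (Fin r') (Fin r) ℂ}
    (hY : Ωc * Y - Y * Ω
      + (Delta B ρ Ω Ωc (fBlk Φ 0) (fBlk Φc 0) Qt₁ Qt₂).toBlocks₂₁ = 0) :
    ∃ (v : ℂ → Matrix (JIdx k s ⊕ Fin q) (Fin r) ℂ) (X : ℂ → Matrix (Fin r) (Fin r) ℂ)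
      (x : Matrix (JIdx k s) (Fin r) ℂ) (L : Matrix (Fin r) (JIdx k s ⊕ Fin q) ℂ),
      AnalyticZero v ∧ AnalyticZero X ∧ v 0 = fromRows (lead B ρ (fBlk Φ 0) Ω) 0 ∧ X 0 = Ω ∧
      HasDerivZero v (fromRows x 0) ∧
      HasDerivZero X (Delta B ρ Ω Ωc (fBlk Φ 0) (fBlk Φc 0) Qt₁ Qt₂).toBlocks₁₁ ∧
      (∀ᶠ c in 𝓝 0, fromBlocks (jordanN k s) 0 0 M * v c
          + scl (gExp k s q ρ) c * (fromBlocks B D₁₂ D₂₁ D₂₂ * (scl (dExp k s q ρ) c * v c))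
          - scl (hExp k s q ρ) c * (v c * X c) = 0 ∧ L * v c = 1) ∧
      (∀ i < ρ - 1, ∀ l, rowBlk x i l = 0) ∧
      rowBlk x (ρ - 1) 1 = Bhat B ρ (ρ - 1) (ρ - 1) * (S B ρ)⁻¹ * fBlk Φ 0 * Ω ∧
      rowBlk x ρ 1 = fBlk Φc 0 * Y ∧
      rowsFrom x (ρ + 1) 1 = Cmat B ρ * fBlk Φ 0 * Ω + G B ρ ρ * fBlk Φc 0 * Y := by
  have hQ : S B ρ * fBlk Φ 0 = fBlk Φ 0 * Ω ^ ρ := S_mul_of_intertwine B (by omega) hΦ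
  have hMinj : ∀ y : Matrix (Fin q) (Fin r) ℂ, M * y = 0 → y = 0 := fun y hy => by
    rw [← Matrix.one_mul y,
      ← Matrix.nonsing_inv_mul _ ((Matrix.isUnit_iff_isUnit_det _).1 hMu), Matrix.mul_assoc, hy,
      Matrix.mul_zero]
  have hmida : midBlk ρ (lead B ρ (fBlk Φ 0) Ω) = Φ := fBlk_ext fun l hl => by
    rw [fBlk_midBlk _ hl, rowBlk_lead_self hρk hl, fBlk_of_intertwine B hΦ hl]
  -- The normalization reads off the `Φ`-component of block `ρ`; on the leading term, whose block
  -- `ρ` is `Φ`, it equals the identity.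
  obtain ⟨L, hL⟩ : ∃ L : Matrix (Fin r) (JIdx k s ⊕ Fin q) ℂ,
      ∀ y : Matrix (JIdx k s ⊕ Fin q) (Fin r) ℂ, L * y = P₁ * midBlk ρ y.toRows₁ := by
    refine ⟨fromCols (P₁ * midBlk ρ (1 : Matrix (JIdx k s) (JIdx k s) ℂ)) 0, fun y => ?_⟩
    conv_lhs => rw [← fromRows_toRows y]
    rw [fromCols_mul_fromRows, Matrix.zero_mul, add_zero, Matrix.mul_assoc, ← midBlk_mul,
      Matrix.one_mul]
  obtain ⟨v, X, v₁, X₁, hv, hX, hv0, hX0, hv1, hX1, hev, heq, hLv⟩ :=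
    exists_analytic_family (fromBlocks (jordanN k s) 0 0 M) (fromBlocks B D₁₂ D₂₁ D₂₂)
      (dExp k s q ρ) (gExp k s q ρ) (hExp k s q ρ)
      L (fromRows (lead B ρ (fBlk Φ 0) Ω) 0) Ω (lead_residual D₁₂ D₂₁ D₂₂ M hρ hρk hW' hQ)
      (by
        intro y Z hy hLy
        obtain ⟨hy2, hlin⟩ := linEq_zero_of_residual hMinj hρ hy
        rw [hL] at hLy
        obtain ⟨hy1, hZ⟩ := hlin.eq_zero hρ hρk hW hW' hΦ hΦc hd hP h₁₁ h₁₂ h₂₁ h₂₂ hLy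
        refine ⟨?_, hZ⟩
        rw [← fromRows_toRows y, hy1, hy2, fromRows_zero])
  obtain ⟨hy2, hlin⟩ := linEq_first_of_residual hMinj hρ hρk heq
  rw [hL] at hLv
  obtain ⟨hX₁, hb⟩ := hlin.first_order hρ hρk hW hW' hΦ hΦc hd hP h₁₁ h₁₂ h₂₁ h₂₂ hLv hQt₁ hQt₂
    hM hMc hY
  refine ⟨v, X, v₁.toRows₁, L, hv, hX, hv0, hX0, ?_, hX₁ ▸ hX1, ?_, hb⟩
  · rw [← hy2, fromRows_toRows]
    exact hv1
  · filter_upwards [hev] with c hc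
    refine ⟨hc.1, hc.2.trans ?_⟩
    rw [hL, toRows₁_fromRows, hmida, h₁₁]

end

/-! ### Identification of `H_0`, `H_1` and removal of the scaling -/

section coefficients

variable {n q r r' ρ : ℕ} {B : Matrix (JIdx k s) (JIdx k s) ℂ}

theorem colsFrom_mul_IG (hρk : ρ ≤ k) (Xi : Matrix (Fin n) (JIdx k s) ℂ) (m : ℕ) :
    colsFrom Xi ρ m * IG B ρ = colBlk Xi ρ m + colsFrom Xi (ρ + 1) m * G B ρ ρ := by
  rw [IG, colsFrom_mul_stack Xi m _ _ le_rfl (Nat.lt_succ_self ρ) hρk, Matrix.mul_one]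

theorem mul_lvl_lead (hρ : 2 ≤ ρ) (hρk : ρ ≤ k) (Xi : Matrix (Fin n) (JIdx k s) ℂ)
    (Q : Matrix (Fin (s ρ)) (Fin r) ℂ) (Ω : Matrix (Fin r) (Fin r) ℂ) (m : ℕ) (hm : m + 1 ≤ ρ) :
    Xi * (lvl k s (m + 1) * lead B ρ Q Ω) = colsFrom Xi ρ (m + 1) * IG B ρ * Q * Ω ^ m := by
  rw [mul_lvl_mul_of_vanish hρ hρk Xi _ _ fun j _ hj => rowBlk_lead_of_lt (by omega) _,
    rowBlk_lead_of_lt (by omega), rowBlk_lead_self hρk hm, rowsFrom_lead m hm, Matrix.mul_zero,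
    zero_add, colsFrom_mul_IG hρk]
  simp only [Matrix.add_mul, Matrix.mul_assoc]

theorem mul_lvl_one_lead_eq_H0 (hρ : 2 ≤ ρ) (hρk : ρ ≤ k) (Xi : Matrix (Fin n) (JIdx k s) ℂ)
    (Q : Matrix (Fin (s ρ)) (Fin r) ℂ) (Ω : Matrix (Fin r) (Fin r) ℂ) :
    Xi * (lvl k s 1 * lead B ρ Q Ω) = H0 B Xi ρ Q := by
  rw [mul_lvl_lead hρ hρk Xi Q Ω 0 (by omega), pow_zero, Matrix.mul_one, H0]

theorem mul_lvl_add_eq_H1 (hρ : 2 ≤ ρ) (hρk : ρ ≤ k) (Xi : Matrix (Fin n) (JIdx k s) ℂ)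
    {Q : Matrix (Fin (s ρ)) (Fin r) ℂ} {Ω : Matrix (Fin r) (Fin r) ℂ}
    {Q₂ : Matrix (Fin (s ρ)) (Fin r') ℂ} {Y : Matrix (Fin r') (Fin r) ℂ}
    {x : Matrix (JIdx k s) (Fin r) ℂ} (hx : ∀ i < ρ - 1, ∀ l, rowBlk x i l = 0)
    (hx₁ : rowBlk x (ρ - 1) 1 = Bhat B ρ (ρ - 1) (ρ - 1) * (S B ρ)⁻¹ * Q * Ω)
    (hx₂ : rowBlk x ρ 1 = Q₂ * Y)
    (hx₃ : rowsFrom x (ρ + 1) 1 = Cmat B ρ * Q * Ω + G B ρ ρ * Q₂ * Y) :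
    Xi * (lvl k s 2 * lead B ρ Q Ω + lvl k s 1 * x) = H1 B Xi ρ Ω Q Q₂ Y := by
  rw [Matrix.mul_add, mul_lvl_lead hρ hρk Xi Q Ω 1 hρ, pow_one,
    mul_lvl_mul_of_vanish hρ hρk Xi x 1 fun j _ hj => hx j hj 1, hx₁, hx₂, hx₃, H1,
    colsFrom_mul_stack Xi 1 _ _ le_rfl (by omega) (by omega), colsFrom_mul_IG hρk,
    colsFrom_mul_IG hρk]
  simp only [Matrix.add_mul, Matrix.mul_add, Matrix.mul_assoc]
  abel

/-- Undoing the scaling of the invariant subspace equation. -/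
theorem unscale (D : Matrix (JIdx k s ⊕ Fin q) (JIdx k s ⊕ Fin q) ℂ)
    (M : Matrix (Fin q) (Fin q) ℂ) (c : ℂ)
    {v : Matrix (JIdx k s ⊕ Fin q) (Fin r) ℂ} {X : Matrix (Fin r) (Fin r) ℂ}
    (h : fromBlocks (jordanN k s) 0 0 M * v
      + scl (gExp k s q ρ) c * (D * (scl (dExp k s q ρ) c * v))
      - scl (hExp k s q ρ) c * (v * X) = 0) :
    (fromBlocks (jordanN k s) 0 0 M + c ^ ρ • D) * (scl (dExp k s q ρ) c * v)
      = scl (dExp k s q ρ) c * v * (c • X) := by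
  -- Truncated subtraction makes `ρ - g` equal to `min l ρ`. As `N` couples level `l` to level `l +
  -- 1`, this matches the column exponent `min ((l + 1) - 1) ρ`; on the complement both exponents
  -- are `0`.
  have hN : scl (fun p => ρ - gExp k s q ρ p) c * fromBlocks (jordanN k s) 0 0 M
      = fromBlocks (jordanN k s) 0 0 M * scl (dExp k s q ρ) c := by
    ext i j
    rw [scl, scl, diagonal_mul, mul_diagonal]
    rcases i with i | i <;> rcases j with j | j
    · simp only [fromBlocks_apply₁₁, jordanN, of_apply]
      split_ifs with hij
      · have h1 : ρ - gExp k s q ρ (Sum.inl i) = dExp k s q ρ (Sum.inl j) := by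
          simp only [gExp, dExp, Sum.elim_inl, hij.2.1]
          omega
        rw [h1, mul_comm]
      · simp
    · simp
    · simp
    · simp [gExp, dExp]
  have hg : scl (fun p => ρ - gExp k s q ρ p) c * scl (gExp k s q ρ) c = c ^ ρ • 1 := by
    rw [scl, scl, diagonal_mul_diagonal, smul_one_eq_diagonal]
    congr 1
    ext i
    rw [← pow_add]
    congr 1
    rcases i with i | i <;> simp [gExp]
  -- Here `h` is what is missing in `1 + min (l - 1) ρ` after `min l ρ`: zero up to level `ρ`, one
  -- beyond.
  have hh : scl (fun p => ρ - gExp k s q ρ p) c * scl (hExp k s q ρ) c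
      = c • scl (dExp k s q ρ) c := by
    rw [scl, scl, scl, diagonal_mul_diagonal, ← diagonal_smul]
    congr 1
    ext i
    simp only [Pi.smul_apply, smul_eq_mul]
    rw [← pow_add, ← pow_succ']
    congr 1
    rcases i with i | i
    · have h1 := i.2.1.2.1
      simp only [gExp, hExp, dExp, Sum.elim_inl]
      split_ifs <;> omega
    · simp [gExp, hExp, dExp]
  have h1 := congrArg (fun T => scl (fun p => ρ - gExp k s q ρ p) c * T) h
  simp only [Matrix.mul_sub, Matrix.mul_add, Matrix.mul_zero, sub_eq_zero] at h1
  rw [← Matrix.mul_assoc, ← Matrix.mul_assoc _ (scl (gExp k s q ρ) c),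
    ← Matrix.mul_assoc _ (scl (hExp k s q ρ) c), hN, hg, hh, Matrix.smul_mul, Matrix.one_mul,
    Matrix.smul_mul] at h1
  rw [Matrix.add_mul, Matrix.smul_mul, ← Matrix.mul_assoc, h1, Matrix.mul_smul, Matrix.mul_assoc]

theorem scl_inv_mul_scl {K : Type*} [Fintype K] [DecidableEq K] (f : K → ℕ) {c : ℂ}
    (hc : c ≠ 0) : scl f c⁻¹ * scl f c = 1 := by
  rw [scl, scl, diagonal_mul_diagonal, ← diagonal_one]
  congr 1
  ext i
  rw [← mul_pow, inv_mul_cancel₀ hc, one_pow]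

end coefficients

/-- Approximate invariance inherited from an exactly invariant subspace by its expansions. -/
theorem approx_invariance {n r : ℕ} {A D : Matrix (Fin n) (Fin n) ℂ}
    {H Ha : ℝ → Matrix (Fin n) (Fin r) ℂ} {C Ca : ℝ → Matrix (Fin r) (Fin r) ℂ} {a b : ℝ}
    (hab : a ≤ b)
    (hinv : ∀ᶠ t : ℝ in 𝓝[>] 0, (A + (t : ℂ) • D) * H t = H t * C t)
    (hC : IsOPow (fun t => C t - Ca t) b) (hH : IsOPow (fun t => H t - Ha t) a)
    (hb : 0 ≤ b) (hCa : IsOPow Ca 0) (hHa : IsOPow Ha 0) :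
    IsOPow (fun t => (A + (t : ℂ) • D) * Ha t - Ha t * Ca t) a := by
  have hA : IsOPow (fun t : ℝ => A + (t : ℂ) • D) 0 := by
    refine (isOPow_const A).add (IsOPow.mono ?_ zero_le_one)
    simpa [tpow] using isOPow_tpow_smul D 1
  have hC0 : IsOPow C 0 := by
    simpa using (hC.mono hb).add hCa
  have h1 := (hA.mul hH).neg
  have h2 := hH.mul hC0
  have h3 := hHa.mul (hC.mono hab)
  rw [zero_add] at h1 h3
  rw [add_zero] at h2
  -- Exact invariance splits the residual into `-(A + tD)(H - Ha)`, `(H - Ha) C` and `Ha (C - Ca)`.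
  refine ((h1.add h2).add h3).congr ?_
  filter_upwards [hinv] with t ht
  rw [Matrix.mul_sub, Matrix.sub_mul, Matrix.mul_sub, ht]
  abel

end JordanPert

end

/-! ### The main theorem -/

open JordanPert

theorem theorem4p1
    (n k q r r' ρ : ℕ) (s : ℕ → ℕ)
    (hk : 0 < s k) (hρ : 2 ≤ ρ) (hρk : ρ ≤ k)
    (A D : Matrix (Fin n) (Fin n) ℂ) (lam0 : ℂ)
    (Xi Sg : Matrix (Fin n) (JordanPert.JIdx k s) ℂ)
    (Xic Sgc : Matrix (Fin n) (Fin q) ℂ)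
    (A22 : Matrix (Fin q) (Fin q) ℂ)
    -- `[Σ Σ_c] = [Ξ Ξ_c]^{-*}`
    (hinv₁ : (fromCols Sg Sgc)ᴴ * fromCols Xi Xic = 1)
    (hinv₂ : fromCols Xi Xic * (fromCols Sg Sgc)ᴴ = 1)
    (hA : A * fromCols Xi Xic
      = fromCols Xi Xic * fromBlocks (lam0 • 1 + JordanPert.jordanN k s) 0 0 A22)
    (hlam0 : lam0 ∉ spectrum ℂ A22)
    (D11 : Matrix (JordanPert.JIdx k s) (JordanPert.JIdx k s) ℂ)
    (hD11 : D11 = Sgᴴ * D * Xi)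
    -- `W_1, …, W_ρ` are invertible, and so is `W_{ρ+1}` if `ρ < k`
    (hW : ∀ i, 1 ≤ i → i ≤ ρ + 1 → i ≤ k → IsUnit (JordanPert.W D11 i))
    (Φ : Matrix (Fin ρ × Fin (s ρ)) (Fin r) ℂ) (Φc : Matrix (Fin ρ × Fin (s ρ)) (Fin r') ℂ)
    (Ω : Matrix (Fin r) (Fin r) ℂ) (Ωc : Matrix (Fin r') (Fin r') ℂ)
    (hΦ : JordanPert.Theta D11 ρ * Φ = Φ * Ω)
    (hΦc : JordanPert.Theta D11 ρ * Φc = Φc * Ωc)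
    (hΦinv : ∃ P : Matrix (Fin r ⊕ Fin r') (Fin ρ × Fin (s ρ)) ℂ,
      P * fromCols Φ Φc = 1 ∧ fromCols Φ Φc * P = 1)
    (hdisj : Disjoint (spectrum ℂ Ω) (spectrum ℂ Ωc))
    -- `Q_1`, `Q_2` are the top blocks of `Φ`, `Φ_c`
    (Q1 : Matrix (Fin (s ρ)) (Fin r) ℂ) (Q2 : Matrix (Fin (s ρ)) (Fin r') ℂ)
    (hQ1 : ∀ x c, Q1 x c = Φ (⟨0, by omega⟩, x) c)
    (hQ2 : ∀ x c, Q2 x c = Φc (⟨0, by omega⟩, x) c)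
    (Qt1 : Matrix (Fin r) (Fin (s ρ)) ℂ) (Qt2 : Matrix (Fin r') (Fin (s ρ)) ℂ)
    (hQt1 : Qt1 * JordanPert.S D11 ρ = Ω ^ ρ * Qt1)
    (hQt2 : Qt2 * JordanPert.S D11 ρ = Ωc ^ ρ * Qt2)
    (hM : IsUnit (JordanPert.Msum ρ Ω Qt1 Q1))
    (hMc : IsUnit (JordanPert.Msum ρ Ωc Qt2 Q2))
    (Y : Matrix (Fin r') (Fin r) ℂ)
    (hY : Ωc * Y - Y * Ω + (JordanPert.Delta D11 ρ Ω Ωc Q1 Q2 Qt1 Qt2).toBlocks₂₁ = 0) :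
    -- the first fractional-order coefficients of an exactly invariant subspace of `A + tD`
    (∃ (H : ℝ → Matrix (Fin n) (Fin r) ℂ) (C : ℝ → Matrix (Fin r) (Fin r) ℂ),
      (∀ᶠ t : ℝ in 𝓝[>] 0, (A + (t : ℂ) • D) * H t = H t * C t ∧ (H t).rank = r) ∧
      JordanPert.IsOPow (fun t => C t - (lam0 • (1 : Matrix (Fin r) (Fin r) ℂ)
          + JordanPert.tpow t (1 / ρ) • Ω
          + JordanPert.tpow t (2 / ρ)
            • (JordanPert.Delta D11 ρ Ω Ωc Q1 Q2 Qt1 Qt2).toBlocks₁₁)) (3 / ρ) ∧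
      JordanPert.IsOPow (fun t => H t - (JordanPert.H0 D11 Xi ρ Q1
          + JordanPert.tpow t (1 / ρ) • JordanPert.H1 D11 Xi ρ Ω Q1 Q2 Y)) (2 / ρ)) ∧
    -- the approximate invariance of `H_0 + t^{1/ρ} H_1`
    JordanPert.IsOPow (fun t =>
      (A + (t : ℂ) • D) * (JordanPert.H0 D11 Xi ρ Q1
          + JordanPert.tpow t (1 / ρ) • JordanPert.H1 D11 Xi ρ Ω Q1 Q2 Y)
        - (JordanPert.H0 D11 Xi ρ Q1
            + JordanPert.tpow t (1 / ρ) • JordanPert.H1 D11 Xi ρ Ω Q1 Q2 Y)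
          * (lam0 • (1 : Matrix (Fin r) (Fin r) ℂ)
            + JordanPert.tpow t (1 / ρ) • Ω
            + JordanPert.tpow t (2 / ρ)
              • (JordanPert.Delta D11 ρ Ω Ωc Q1 Q2 Qt1 Qt2).toBlocks₁₁)) (2 / ρ) := by
  have hW₁ : IsUnit (W D11 ρ) := hW ρ (by omega) (by omega) hρk
  have hW₂ : IsUnit (W D11 (ρ + 1)) := by
    by_cases h : ρ + 1 ≤ k
    · exact hW (ρ + 1) (by omega) le_rfl h
    -- For `ρ = k` the matrix `W_{ρ+1}` is empty, hence invertible, so no separate case is needed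
    -- later.
    · have : IsEmpty (TIdx (ρ + 1) k s) := ⟨fun p => h (p.1.2.1.trans p.1.2.2)⟩
      exact isUnit_of_subsingleton _
  have hQ1' : Q1 = fBlk Φ 0 := by
    ext x c
    exact (hQ1 x c).trans (fBlk_apply Φ _ x c).symm
  have hQ2' : Q2 = fBlk Φc 0 := by
    ext x c
    exact (hQ2 x c).trans (fBlk_apply Φc _ x c).symm
  subst hQ1' hQ2'
  obtain ⟨P, hPl, hPr⟩ := hΦinv
  have hPl' : fromBlocks (P.toRows₁ * Φ) (P.toRows₁ * Φc) (P.toRows₂ * Φ) (P.toRows₂ * Φc)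
      = 1 := by
    rw [← fromRows_mul_fromCols, fromRows_toRows, hPl]
  rw [← fromBlocks_one, fromBlocks_inj] at hPl'
  obtain ⟨h₁₁, h₁₂, h₂₁, h₂₂⟩ := hPl'
  have hP : Φ * P.toRows₁ + Φc * P.toRows₂ = 1 := by
    rw [← fromCols_mul_fromRows, fromRows_toRows, hPr]
  have hA22 : IsUnit (A22 - lam0 • (1 : Matrix (Fin q) (Fin q) ℂ)) := by
    have h := (spectrum.notMem_iff.1 hlam0).neg
    rwa [neg_sub, Algebra.algebraMap_eq_smul_one] at h
  set V := fromCols Xi Xic with hV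
  set Vi := (fromCols Sg Sgc)ᴴ with hVi
  have hDf : Vi * D * V = fromBlocks D11 (Sgᴴ * D * Xic) (Sgcᴴ * D * Xi) (Sgcᴴ * D * Xic) := by
    rw [hVi, hV, conjTranspose_fromCols_eq_fromRows_conjTranspose, fromRows_mul,
      fromRows_mul_fromCols, hD11]
  obtain ⟨v, X, x, L, hv, hX, hv0, hX0, hv1, hX1, hev, hxs, hx₁, hx₂, hx₃⟩ :=
    exists_scaled_family (Sgᴴ * D * Xic) (Sgcᴴ * D * Xi) (Sgcᴴ * D * Xic) _ hA22 hρ hρk hW₁ hW₂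
      hΦ hΦc hdisj hP h₁₁ h₁₂ h₂₁ h₂₂ hQt1 hQt2 hM hMc hY
  rw [← hDf] at hev
  have hρ0 : (0 : ℝ) < 1 / ρ := by
    have : 0 < ρ := by omega
    positivity
  set τ : ℝ → ℂ := fun t => tpow t (1 / ρ) with hτ
  have hτ0 : Tendsto τ (𝓝[>] 0) (𝓝 0) := tendsto_tpow hρ0
  have hτρ : ∀ {t : ℝ}, 0 < t → τ t ^ ρ = t := fun {t} ht => by
    have : (ρ : ℝ) ≠ 0 := by
      have : ρ ≠ 0 := by omega
      exact_mod_cast this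
    rw [hτ]
    simp only
    rw [tpow_pow ht, one_div_mul_cancel this, tpow, Real.rpow_one]
  have hτne : ∀ {t : ℝ}, 0 < t → τ t ≠ 0 := fun {t} ht h => by
    have h1 := hτρ ht
    rw [h, zero_pow (by omega)] at h1
    exact ht.ne (by exact_mod_cast h1)
  have hτ2 : ∀ {t : ℝ}, 0 < t → tpow t (2 / ρ) = τ t * τ t := fun {t} ht => by
    rw [← pow_two, hτ]
    simp only
    rw [tpow_pow ht]
    congr 1
    push_cast
    ring
  have hAV : ∀ c : ℂ, (A + c • D) * V
      = V * (lam0 • 1 + (fromBlocks (jordanN k s) 0 0 (A22 - lam0 • 1) + c • (Vi * D * V))) := by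
    intro c
    have h1 : (lam0 • (1 : Matrix (JIdx k s ⊕ Fin q) (JIdx k s ⊕ Fin q) ℂ)
        + fromBlocks (jordanN k s) 0 0 (A22 - lam0 • 1))
        = fromBlocks (lam0 • 1 + jordanN k s) 0 0 A22 := by
      rw [← fromBlocks_one, fromBlocks_smul, fromBlocks_add]
      simp
    rw [← add_assoc, h1, Matrix.mul_add, ← hA, Matrix.mul_smul, Matrix.mul_assoc Vi,
      ← Matrix.mul_assoc V, hinv₂, Matrix.one_mul, Matrix.add_mul, Matrix.smul_mul]
  let H : ℝ → Matrix (Fin n) (Fin r) ℂ := fun t => V * (scl (dExp k s q ρ) (τ t) * v (τ t))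
  let C : ℝ → Matrix (Fin r) (Fin r) ℂ := fun t => lam0 • 1 + τ t • X (τ t)
  have hinv : ∀ᶠ t : ℝ in 𝓝[>] 0, (A + (t : ℂ) • D) * H t = H t * C t ∧ (H t).rank = r := by
    filter_upwards [hτ0.eventually hev, self_mem_nhdsWithin] with t ht ht0
    have hu := unscale (Vi * D * V) _ (τ t) ht.1
    rw [hτρ ht0] at hu
    constructor
    · simp only [H, C]
      rw [← Matrix.mul_assoc, hAV, Matrix.mul_assoc, Matrix.add_mul, hu, Matrix.mul_add,
        Matrix.mul_add]
      simp only [Matrix.smul_mul, Matrix.mul_smul, Matrix.one_mul, Matrix.mul_one,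
        Matrix.mul_assoc]
    -- Although `c^d` degenerates as `c → 0`, it is invertible for each `c ≠ 0`, so the
    -- normalization of `v` gives a left inverse of `H t`.
    · refine rank_eq_of_leftInverse (L := L * scl (dExp k s q ρ) (τ t)⁻¹ * Vi) ?_
      calc L * scl (dExp k s q ρ) (τ t)⁻¹ * Vi * H t
          = L * (scl (dExp k s q ρ) (τ t)⁻¹ * ((Vi * V) * scl (dExp k s q ρ) (τ t))) * v (τ t) := by
            simp only [H, Matrix.mul_assoc]
        _ = 1 := by
            rw [hinv₁, Matrix.one_mul, scl_inv_mul_scl _ (hτne ht0), Matrix.mul_one, ht.2]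
  -- The derivative of `c^d v` at `0` is level two of the leading term plus level one of the first
  -- order term, which `V` maps to `H_1`.
  have hHd : HasDerivZero (fun c => V * (scl (dExp k s q ρ) c * v c))
      (H1 D11 Xi ρ Ω (fBlk Φ 0) (fBlk Φc 0) Y) := by
    have h := (HasDerivZero.const V).mul ((hasDerivZero_scl (dExp k s q ρ)).mul hv1)
    rw [Matrix.zero_mul, zero_add, hv0, scl_zero, ← fromRows_toRows (_ + _), hV,
      fromCols_mul_fromRows, dExp, toRows₁_add, toRows₂_add, toRows₁_lev_mul, toRows₁_lev_mul,
      toRows₂_lev_mul, toRows₂_lev_mul, toRows₁_fromRows, toRows₁_fromRows, toRows₂_fromRows,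
      toRows₂_fromRows, lev_d_zero hρ, lev_d_one hρ, Matrix.mul_zero, Matrix.mul_zero, add_zero,
      Matrix.mul_zero, add_zero, mul_lvl_add_eq_H1 hρ hρk Xi hxs hx₁ hx₂ hx₃] at h
    exact h
  have hHa : AnalyticZero (fun c => V * (scl (dExp k s q ρ) c * v c)) :=
    (analyticZero_const V).mul ((analyticZero_scl _).mul hv)
  have hHz : V * (scl (dExp k s q ρ) 0 * v 0) = H0 D11 Xi ρ (fBlk Φ 0) := by
    rw [hv0, scl_zero, ← fromRows_toRows (lev _ _ * _), hV, fromCols_mul_fromRows, dExp,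
      toRows₁_lev_mul, toRows₂_lev_mul, toRows₁_fromRows, toRows₂_fromRows, lev_d_zero hρ,
      Matrix.mul_zero, Matrix.mul_zero, add_zero, mul_lvl_one_lead_eq_H0 hρ hρk]
  have hH : IsOPow (fun t => H t - (H0 D11 Xi ρ (fBlk Φ 0)
      + tpow t (1 / ρ) • H1 D11 Xi ρ Ω (fBlk Φ 0) (fBlk Φc 0) Y)) (2 / ρ) := by
    have h := isOPow_taylor hHa hHd (ρ := ρ) (by omega)
    rw [hHz] at h
    exact h
  have hC : IsOPow (fun t => C t - (lam0 • (1 : Matrix (Fin r) (Fin r) ℂ)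
      + tpow t (1 / ρ) • Ω + tpow t (2 / ρ)
        • (Delta D11 ρ Ω Ωc (fBlk Φ 0) (fBlk Φc 0) Qt1 Qt2).toBlocks₁₁)) (3 / ρ) := by
    have h := isOPow_taylor hX hX1 (ρ := ρ) (by omega)
    rw [hX0] at h
    -- The factor `c` in `C = λ₀ + c X(c)` raises the error from `2 / ρ` to `3 / ρ`.
    have h2 := (isOPow_tpow_smul (1 : Matrix (Fin r) (Fin r) ℂ) (1 / ρ)).mul h
    have e : (1 / ρ + 2 / ρ : ℝ) = 3 / ρ := by ring
    rw [e] at h2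
    refine h2.congr ?_
    filter_upwards [self_mem_nhdsWithin] with t ht
    rw [hτ2 ht]
    simp only [C, hτ, Matrix.smul_mul, Matrix.one_mul, smul_sub, smul_add, smul_smul]
    abel
  refine ⟨⟨H, C, hinv, hC, hH⟩, ?_⟩
  have hmono : ∀ {a : ℝ}, 0 ≤ a → 0 ≤ a / ρ := fun ha => by positivity
  refine approx_invariance ?_ (hinv.mono fun t ht => ht.1) hC hH (hmono (by norm_num)) ?_ ?_
  · gcongr
    norm_num
  · exact ((isOPow_const _).add ((isOPow_tpow_smul _ _).mono hρ0.le)).add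
      ((isOPow_tpow_smul _ _).mono (hmono (by norm_num)))
  · exact (isOPow_const _).add ((isOPow_tpow_smul _ _).mono hρ0.le)
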